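/- Theorem (Yokoyama). Over $\mathsf{RCA}_0$, the principle $\mathsf{RKLp}$ implies the $\Pi^0_2$-partition principle, and it also implies $\mathsf{SRT}^2_2$. That is: let $\mathcal M=(M,S)$ be any model of $\mathsf{RCA}_0$, where $M$ is the (possibly nonstandard) first order part and $S\subseteq\mathcal P(M)$ is the second order part, and suppose that $\mathcal M\models\mathsf{RKLp}$. Then $\mathcal M$ satisfies both the $\Pi^0_2$-partition principle and $\mathsf{SRT}^2_2$. Here a set $X\subseteq M$ is called infinite if it is unbounded in $M$, strings are the (codes of) finite $\{0,1\}$-valued strings in the sense of $\mathcal M$, and $\preceq$ denotes the initial segment relation. The principles are as follows. $\mathsf{RKLp}$: for each infinite set $\Sigma\in S$ of strings there are an infinite set $H\in S$ and a color $c\in\{0,1\}$ such that, for arbitrarily large $l$, there is a string $\tau$ of length $l$ in $T_\Sigma=\{\tau : (\exists\sigma\in\Sigma)\ \tau\preceq\sigma\}$ with $\tau(x)=c$ for all $x\in H$ with $x<l$. $\Pi^0_2$-partition: whenever $A_0,A_1\subseteq M$ are $\Pi^0_2$-definable in $\mathcal M$ with parameters (they need not belong to $S$) and $A_0\cup A_1=M$,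 there is an infinite set $H\in S$ with $H\subseteq A_0$ or $H\subseteq A_1$. $\mathsf{SRT}^2_2$: every coloring $f\in S$ of the two-element subsets of $M$ in the colors $0,1$ which is stable (for each $x$ there is $t>x$ such that $f(x,y)=f(x,t)$ for all $y>t$) has an infinite homogeneous set $H\in S$. -/

import Mathlib

/-! Structures for the language of second order arithmetic: a first order part `M` together with
a family `S : Set (Set M)` over which the set variables range. -/

universe u

namespace SecondOrderArith

/-- The first order part of a structure for the language of second order arithmetic: a type with
interpretations of the symbols `0, 1, +, *, <`. No laws are assumed here. -/
class ArithStructure (M : Type u) extends Zero M, One M, Add M, Mul M, LT M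

/-- Numerical terms; variables are indexed by `ℕ`. -/
inductive NumTerm : Type
  | var : ℕ → NumTerm
  | zero : NumTerm
  | one : NumTerm
  | add : NumTerm → NumTerm → NumTerm
  | mul : NumTerm → NumTerm → NumTerm

/-- `Σ⁰₀` formulas: number quantifiers are bounded and there are no set quantifiers.
Number variables are de Bruijn indices: in `ball t φ` (for all `x < t`, `φ`) and `bex t φ`
(there is `x < t` with `φ`), the variable `0` of `φ` is the quantified one and the variable `k + 1`
of `φ` is the variable `k` outside; the bound `t` is read outside the quantifier. In `mem t i` the
second argument is the index of a set variable. -/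
inductive BddFormula : Type
  | eq : NumTerm → NumTerm → BddFormula
  | lt : NumTerm → NumTerm → BddFormula
  | mem : NumTerm → ℕ → BddFormula
  | neg : BddFormula → BddFormula
  | and : BddFormula → BddFormula → BddFormula
  | or : BddFormula → BddFormula → BddFormula
  | ball : NumTerm → BddFormula → BddFormula
  | bex : NumTerm → BddFormula → BddFormula

section Semantics

variable {M : Type u} [ArithStructure M]

/-- The assignment that gives `a` to variable `0` and shifts `e` by one. -/
def cons (a : M) (e : ℕ → M) : ℕ → M
  | 0 => a
  | k + 1 => e k

/-- Value of a term under an assignment. -/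
def NumTerm.val (e : ℕ → M) : NumTerm → M
  | .var k => e k
  | .zero => 0
  | .one => 1
  | .add s t => s.val e + t.val e
  | .mul s t => s.val e * t.val e

/-- Truth of a `Σ⁰₀` formula, with `e` assigning elements to the number variables and `E` assigning
sets to the set variables. -/
def BddFormula.Holds (E : ℕ → Set M) : BddFormula → (ℕ → M) → Prop
  | .eq s t, e => s.val e = t.val e
  | .lt s t, e => s.val e < t.val e
  | .mem t i, e => t.val e ∈ E i
  | .neg φ, e => ¬ φ.Holds E e
  | .and φ ψ, e => φ.Holds E e ∧ ψ.Holds E e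
  | .or φ ψ, e => φ.Holds E e ∨ ψ.Holds E e
  | .ball t φ, e => ∀ x : M, x < t.val e → φ.Holds E (cons x e)
  | .bex t φ, e => ∃ x : M, x < t.val e ∧ φ.Holds E (cons x e)

/-- `A` is defined by a `Σ⁰₁` formula `∃ m, θ(x, m)` with number parameters from `M` and set
parameters from `S`. -/
def IsSigma01 (S : Set (Set M)) (A : Set M) : Prop :=
  ∃ (θ : BddFormula) (e : ℕ → M) (E : ℕ → Set M), (∀ i, E i ∈ S) ∧
    ∀ x : M, x ∈ A ↔ ∃ m : M, θ.Holds E (cons m (cons x e))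

/-- `A` is defined by a `Π⁰₁` formula `∀ m, θ(x, m)` with parameters. -/
def IsPi01 (S : Set (Set M)) (A : Set M) : Prop :=
  ∃ (θ : BddFormula) (e : ℕ → M) (E : ℕ → Set M), (∀ i, E i ∈ S) ∧
    ∀ x : M, x ∈ A ↔ ∀ m : M, θ.Holds E (cons m (cons x e))

/-- `A` is defined by a `Π⁰₂` formula `∀ m, ∃ n, θ(x, m, n)` with parameters. -/
def IsPi02 (S : Set (Set M)) (A : Set M) : Prop :=
  ∃ (θ : BddFormula) (e : ℕ → M) (E : ℕ → Set M), (∀ i, E i ∈ S) ∧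
    ∀ x : M, x ∈ A ↔ ∀ m : M, ∃ n : M, θ.Holds E (cons n (cons m (cons x e)))

/-- `(M, S)` is a model of `RCA₀`: the basic axioms, `Σ⁰₁` induction and `Δ⁰₁` comprehension,
the last two with number and set parameters. The range of the set variables is nonempty, as the
domains of a structure always are. -/
structure IsModelRCA0 (S : Set (Set M)) : Prop where
  sets_nonempty : S.Nonempty
  succ_ne_zero : ∀ n : M, n + 1 ≠ 0
  succ_inj : ∀ m n : M, m + 1 = n + 1 → m = n
  add_zero : ∀ m : M, m + 0 = m
  add_succ : ∀ m n : M, m + (n + 1) = (m + n) + 1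
  mul_zero : ∀ m : M, m * 0 = 0
  mul_succ : ∀ m n : M, m * (n + 1) = m * n + m
  not_lt_zero : ∀ m : M, ¬ m < 0
  lt_succ : ∀ m n : M, m < n + 1 ↔ m < n ∨ m = n
  sigma01_induction : ∀ A : Set M, IsSigma01 S A →
    0 ∈ A → (∀ n, n ∈ A → n + 1 ∈ A) → ∀ n, n ∈ A
  delta01_comprehension : ∀ A : Set M, IsSigma01 S A → IsPi01 S A → A ∈ S

/-- `A` is infinite in the sense of `M`, that is, unbounded. -/
def Unbounded (A : Set M) : Prop := ∀ b : M, ∃ x ∈ A, b < x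

/-- The pairing map of second order arithmetic, `(i, j) = (i + j)² + i`. -/
def pair (i j : M) : M := (i + j) * (i + j) + i

/-! Codes of finite binary strings. For numbers `m, n` let the bit at `i` be `1` if
`m (i + 1) + 1` divides `n`, and `0` otherwise. The code of a binary string `σ` of length `l` is
the number `(l, (m, n))` where `(m, n)` is the least pair whose bits at the `i < l` are those of
`σ`. Thus every string has exactly one code. -/

/-- The bit at `i` given by `m, n` is `1`. -/
def Bit (m n i : M) : Prop := ∃ q : M, n = (m * (i + 1) + 1) * q

/-- `s` is the code `(l, (m, n))` of a binary string of length `l`. -/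
def IsCode (s l m n : M) : Prop :=
  s = pair l (pair m n) ∧
    ∀ m' n' : M, (∀ i : M, i < l → (Bit m' n' i ↔ Bit m n i)) → ¬ pair m' n' < pair m n

/-- `s` is (the code of) a finite binary string. -/
def IsString (s : M) : Prop := ∃ l m n : M, IsCode s l m n

/-- The string `s` has length `l`. -/
def HasLength (s l : M) : Prop := ∃ m n : M, IsCode s l m n

/-- The string `s` is defined at `x` and `s(x) = c`, where `c` is `0` or `1`. -/
def HasValue (s x c : M) : Prop :=
  ∃ l m n : M, IsCode s l m n ∧ x < l ∧ ((c = 1 ∧ Bit m n x) ∨ (c = 0 ∧ ¬ Bit m n x))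

/-- The string `t` is an initial segment of the string `s`. -/
def IsPrefix (t s : M) : Prop :=
  ∃ k l : M, HasLength t k ∧ HasLength s l ∧ (k < l ∨ k = l) ∧
    ∀ x : M, x < k → ∀ c : M, HasValue t x c ↔ HasValue s x c

/-- `T_A`, the downward closure of a set `A` of strings. It need not belong to `S`. -/
def downClosure (A : Set M) : Set M := {t | ∃ s ∈ A, IsPrefix t s}

/-- `H` is homogeneous for the string `s` with color `c`. -/
def HomogFor (H : Set M) (s c : M) : Prop :=
  ∀ x ∈ H, ∀ l : M, HasLength s l → x < l → HasValue s x c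

/-- `H` is homogeneous for a path through `T`: for some color `c`, it is homogeneous with color `c`
for arbitrarily long strings of `T`. -/
def HomogForPath (H T : Set M) : Prop :=
  ∃ c : M, (c = 0 ∨ c = 1) ∧
    ∀ b : M, ∃ t ∈ T, ∃ l : M, HasLength t l ∧ b < l ∧ HomogFor H t c

/-- `RKLp` holds in `(M, S)`: for each infinite set `A` of strings there is an infinite set `H`
which is homogeneous for a path through the downward closure of `A`. -/
def RKLp (S : Set (Set M)) : Prop :=
  ∀ A ∈ S, (∀ s ∈ A, IsString s) → Unbounded A →
    ∃ H ∈ S, Unbounded H ∧ HomogForPath H (downClosure A)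

/-- The `Π⁰₂`-partition principle holds in `(M, S)`. The sets `A₀, A₁` need not belong to `S`. -/
def Pi02Partition (S : Set (Set M)) : Prop :=
  ∀ A₀ A₁ : Set M, IsPi02 S A₀ → IsPi02 S A₁ → A₀ ∪ A₁ = Set.univ →
    ∃ H ∈ S, Unbounded H ∧ (H ⊆ A₀ ∨ H ⊆ A₁)

/-- `F` is (the graph of) a coloring `f : [M]² → {0, 1}`: it consists of triples `((x, y), i)`
with `x < y` and `i ∈ {0, 1}`, exactly one for each pair `x < y`. -/
def IsColoring (F : Set M) : Prop :=
  (∀ p ∈ F, ∃ x y i : M, x < y ∧ (i = 0 ∨ i = 1) ∧ p = pair (pair x y) i) ∧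
    ∀ x y : M, x < y → ∃! i : M, pair (pair x y) i ∈ F

/-- The coloring `F` is stable: for each `x` there is `t > x` such that `f(x, y) = f(x, t)` for all
`y > t`. -/
def IsStable (F : Set M) : Prop :=
  ∀ x : M, ∃ t : M, x < t ∧ ∀ y : M, t < y →
    ∀ i : M, pair (pair x y) i ∈ F ↔ pair (pair x t) i ∈ F

/-- `SRT²₂` holds in `(M, S)`: each stable coloring of pairs into two colors has an infinite
homogeneous set. -/
def SRT22 (S : Set (Set M)) : Prop :=
  ∀ F ∈ S, IsColoring F → IsStable F →
    ∃ H ∈ S, Unbounded H ∧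
      ∃ i : M, ∀ x ∈ H, ∀ y ∈ H, x < y → pair (pair x y) i ∈ F

end Semantics

end SecondOrderArith

/-! Partition. Let `A_i` be given by `∀ m ∃ n, T_i`. At stage `s` compare how far the membership of
`x` in the two sets has been confirmed: `C x s` says that for each `m ≤ s`, if all `k ≤ m` have
`T_0`-witnesses `≤ s`, then they have `T_1`-witnesses `≤ s`. Apply `RKLp` to the strings of length
`s` with bit `C x s` at `x` (`exists_homogeneous_of_RKLp`). If `C x s` holds for arbitrarily large
`s`, then `x ∈ A_1`: otherwise `x ∈ A_0`, and at a late stage `A_0` is confirmed up to a level at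
which `A_1` fails. If it fails for arbitrarily large `s`, then dually `x ∈ A_0`. So `H` lies in one
of the sets.

Stable colorings. The points that take color `i` cofinally form a `Π⁰₂` set, and the sets for `i =
0, 1` cover `M`. The partition principle thus gives `H ∈ S` all of whose points have the same limit
color, and `H` is thinned greedily to a homogeneous `K`. If `K` were bounded, each of its points
would exclude only a bounded part of `H`, and these parts would have to be bounded together. The
number of points may be nonstandard, so this needs the infinite pigeonhole principle, which is
itself drawn from `RKLp` (`pigeonhole_of_RKLp`).

Pigeonhole. Suppose each `j < a` is hit boundedly often, but the hits are unbounded. Order the `j <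
a` by their last hit before stage `s`, and compare these orders lexicographically. The last element
at stage `x` is later overtaken by some `j₀` that in turn stops being hit; the part up to `j₀` then
settles and differs from what it was at `x`. So stage `x` eventually precedes, or eventually
follows, all later stages (`eventually_precedes`). `RKLp` gives an infinite `H` on which one
alternative always holds. But the orders that occur in `H` all occur at stages below a bound
(`exists_bound_relations`), so some stage in `H` is extremal: a contradiction.

The arithmetic below is derived from the axioms; its core is bounded `Σ⁰₁` comprehension by Gödel's
coding (`exists_code`). -/

namespace SecondOrderArith

/-! ### `Σ⁰₀` definability with parameters -/

section Definability

/-- Renaming of the variables of a term. -/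
def NumTerm.rename (r : ℕ → ℕ) : NumTerm → NumTerm
  | .var k => .var (r k)
  | .zero => .zero
  | .one => .one
  | .add s t => .add (s.rename r) (t.rename r)
  | .mul s t => .mul (s.rename r) (t.rename r)

/-- The renaming that fixes the variable `0` and acts as `r` on the others. -/
def liftVar (r : ℕ → ℕ) : ℕ → ℕ
  | 0 => 0
  | k + 1 => r k + 1

/-- Renaming of the free number variables and of the set variables of a formula. -/
def BddFormula.rename (p : ℕ → ℕ) : BddFormula → (ℕ → ℕ) → BddFormula
  | .eq s t, r => .eq (s.rename r) (t.rename r)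
  | .lt s t, r => .lt (s.rename r) (t.rename r)
  | .mem t i, r => .mem (t.rename r) (p i)
  | .neg φ, r => .neg (φ.rename p r)
  | .and φ ψ, r => .and (φ.rename p r) (ψ.rename p r)
  | .or φ ψ, r => .or (φ.rename p r) (ψ.rename p r)
  | .ball t φ, r => .ball (t.rename r) (φ.rename p (liftVar r))
  | .bex t φ, r => .bex (t.rename r) (φ.rename p (liftVar r))

/-- The sequence with `v` at the even places and `e` at the odd ones. -/
def mix {α : Type*} (v e : ℕ → α) (k : ℕ) : α := if k % 2 = 0 then v (k / 2) else e (k / 2)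

theorem cons_comp_liftVar {M : Type u} (x : M) (v : ℕ → M) (r : ℕ → ℕ) :
    cons x v ∘ liftVar r = cons x (v ∘ r) := by
  funext k; cases k <;> rfl

/-- Parameter `c` of `e` is entry `2c` of `mix e e'`, hence at place `4c + 1` after mixing with `v`;
this is `2k - 1` for `k = 2c + 1`. Interleaving parameters lets two formulas share one assignment.
-/
theorem mix_comp_left {α : Type*} (v e e' : ℕ → α) :
    mix v (mix e e') ∘ (fun k => if k % 2 = 0 then k else 2 * k - 1) = mix v e := by
  funext k
  rcases Nat.even_or_odd' k with ⟨c, rfl | rfl⟩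
  · simp [mix]
  · have h1 : (2 * c + 1) % 2 = 1 := by omega
    have h2 : (2 * (2 * c + 1) - 1) % 2 = 1 := by omega
    have h3 : (2 * (2 * c + 1) - 1) / 2 = 2 * c := by omega
    have h4 : (2 * c + 1) / 2 = c := by omega
    simp [mix, h1, h2, h3, h4]

theorem mix_comp_right {α : Type*} (v e e' : ℕ → α) :
    mix v (mix e e') ∘ (fun k => if k % 2 = 0 then k else 2 * k + 1) = mix v e' := by
  funext k
  rcases Nat.even_or_odd' k with ⟨c, rfl | rfl⟩
  · simp [mix]
  · have h1 : (2 * c + 1) % 2 = 1 := by omega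
    have h2 : (2 * (2 * c + 1) + 1) % 2 = 1 := by omega
    have h3 : (2 * (2 * c + 1) + 1) / 2 = 2 * c + 1 := by omega
    have h4 : (2 * c + 1) / 2 = c := by omega
    simp [mix, h1, h2, h3, h4]

theorem mix_comp_two_mul {α : Type*} (E E' : ℕ → α) : mix E E' ∘ (fun i => 2 * i) = E := by
  funext k; simp [mix]

theorem mix_comp_two_mul_add_one {α : Type*} (E E' : ℕ → α) :
    mix E E' ∘ (fun i => 2 * i + 1) = E' := by
  funext k
  have h1 : (2 * k + 1) % 2 = 1 := by omega
  have h2 : (2 * k + 1) / 2 = k := by omega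
  simp [mix, h1, h2]

theorem mix_mem {M : Type u} {S : Set (Set M)} {E E' : ℕ → Set M} (h : ∀ i, E i ∈ S) (h' : ∀ i, E' i ∈ S) (i : ℕ) :
    mix E E' i ∈ S := by
  unfold mix; split_ifs
  exacts [h _, h' _]

/-- A quantifier pushes a value in front and so swaps the parities of variables and parameters; this
renaming restores them. -/
theorem mix_cons {M : Type u} (x : M) (v e : ℕ → M) :
    cons x (mix v e) ∘ (fun k => if k = 0 then 0 else if k % 2 = 0 then k - 1 else k + 1) =
      mix (cons x v) e := by
  funext k
  rcases Nat.even_or_odd' k with ⟨c, rfl | rfl⟩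
  · cases c with
    | zero => simp [mix, cons]
    | succ c =>
      have h1 : 2 * (c + 1) - 1 = 2 * c + 1 := by omega
      simp [mix, cons, h1]
  · have h1 : (2 * c + 1) % 2 = 1 := by omega
    have h2 : (2 * c + 1) / 2 = c := by omega
    simp [mix, cons, h1, h2]

variable {M : Type u} [ArithStructure M] {S : Set (Set M)}

theorem NumTerm.val_rename (r : ℕ → ℕ) (v : ℕ → M) (t : NumTerm) :
    (t.rename r).val v = t.val (v ∘ r) := by
  induction t with
  | var k => rfl
  | zero => rfl
  | one => rfl
  | add s t hs ht => simp only [NumTerm.rename, NumTerm.val, hs, ht]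
  | mul s t hs ht => simp only [NumTerm.rename, NumTerm.val, hs, ht]

theorem BddFormula.holds_rename (p : ℕ → ℕ) (E : ℕ → Set M) (φ : BddFormula) :
    ∀ (r : ℕ → ℕ) (v : ℕ → M), (φ.rename p r).Holds E v ↔ φ.Holds (E ∘ p) (v ∘ r) := by
  induction φ with
  | eq s t => intro r v; simp only [rename, Holds, NumTerm.val_rename]
  | lt s t => intro r v; simp only [rename, Holds, NumTerm.val_rename]
  | mem t i => intro r v; simp only [rename, Holds, NumTerm.val_rename, Function.comp_apply]
  | neg φ h => intro r v; simp only [rename, Holds, h]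
  | and φ ψ h h' => intro r v; simp only [rename, Holds, h, h']
  | or φ ψ h h' => intro r v; simp only [rename, Holds, h, h']
  | ball t φ h => intro r v; simp only [rename, Holds, NumTerm.val_rename, h, cons_comp_liftVar]
  | bex t φ h => intro r v; simp only [rename, Holds, NumTerm.val_rename, h, cons_comp_liftVar]

/-- `f` is given by a term with parameters. -/
def IsTerm (f : (ℕ → M) → M) : Prop := ∃ (t : NumTerm) (e : ℕ → M), ∀ v, f v = t.val (mix v e)

/-- `P` is given by a `Σ⁰₀` formula with parameters. -/
def IsBdd (S : Set (Set M)) (P : (ℕ → M) → Prop) : Prop :=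
  ∃ (θ : BddFormula) (e : ℕ → M) (E : ℕ → Set M), (∀ i, E i ∈ S) ∧
    ∀ v, P v ↔ θ.Holds E (mix v e)

theorem IsTerm.common {f g : (ℕ → M) → M} (hf : IsTerm f) (hg : IsTerm g) :
    ∃ (s t : NumTerm) (e : ℕ → M), (∀ v, f v = s.val (mix v e)) ∧ ∀ v, g v = t.val (mix v e) := by
  obtain ⟨s, e, hs⟩ := hf
  obtain ⟨t, e', ht⟩ := hg
  refine ⟨s.rename (fun k => if k % 2 = 0 then k else 2 * k - 1),
    t.rename (fun k => if k % 2 = 0 then k else 2 * k + 1), mix e e', fun v => ?_, fun v => ?_⟩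
  · rw [hs, NumTerm.val_rename, mix_comp_left]
  · rw [ht, NumTerm.val_rename, mix_comp_right]

theorem IsBdd.common {P Q : (ℕ → M) → Prop} (hP : IsBdd S P) (hQ : IsBdd S Q) :
    ∃ (θ η : BddFormula) (e : ℕ → M) (E : ℕ → Set M), (∀ i, E i ∈ S) ∧
      (∀ v, P v ↔ θ.Holds E (mix v e)) ∧ ∀ v, Q v ↔ η.Holds E (mix v e) := by
  obtain ⟨θ, e, E, hE, hθ⟩ := hP
  obtain ⟨η, e', E', hE', hη⟩ := hQ
  refine ⟨θ.rename (fun i => 2 * i) (fun k => if k % 2 = 0 then k else 2 * k - 1),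
    η.rename (fun i => 2 * i + 1) (fun k => if k % 2 = 0 then k else 2 * k + 1), mix e e',
    mix E E', mix_mem hE hE', fun v => ?_, fun v => ?_⟩
  · rw [hθ, BddFormula.holds_rename, mix_comp_left, mix_comp_two_mul]
  · rw [hη, BddFormula.holds_rename, mix_comp_right, mix_comp_two_mul_add_one]

theorem IsTerm.common_isBdd {f : (ℕ → M) → M} {Q : (ℕ → M) → Prop} (hf : IsTerm f)
    (hQ : IsBdd S Q) :
    ∃ (t : NumTerm) (η : BddFormula) (e : ℕ → M) (E : ℕ → Set M), (∀ i, E i ∈ S) ∧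
      (∀ v, f v = t.val (mix v e)) ∧ ∀ v, Q v ↔ η.Holds E (mix v e) := by
  obtain ⟨t, e, ht⟩ := hf
  obtain ⟨η, e', E', hE', hη⟩ := hQ
  refine ⟨t.rename (fun k => if k % 2 = 0 then k else 2 * k - 1),
    η.rename id (fun k => if k % 2 = 0 then k else 2 * k + 1), mix e e', E', hE',
    fun v => ?_, fun v => ?_⟩
  · rw [ht, NumTerm.val_rename, mix_comp_left]
  · rw [hη, BddFormula.holds_rename, mix_comp_right, Function.comp_id]

theorem IsTerm.var (k : ℕ) : IsTerm (fun v : ℕ → M => v k) :=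
  ⟨.var (2 * k), fun _ => 0, fun v => by simp [NumTerm.val, mix]⟩

theorem IsTerm.const (a : M) : IsTerm (fun _ : ℕ → M => a) :=
  ⟨.var 1, fun _ => a, fun v => by simp [NumTerm.val, mix]⟩

theorem IsTerm.add {f g : (ℕ → M) → M} (hf : IsTerm f) (hg : IsTerm g) :
    IsTerm (fun v => f v + g v) := by
  obtain ⟨s, t, e, hs, ht⟩ := hf.common hg
  exact ⟨.add s t, e, fun v => by beta_reduce; rw [hs, ht]; rfl⟩

theorem IsTerm.mul {f g : (ℕ → M) → M} (hf : IsTerm f) (hg : IsTerm g) :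
    IsTerm (fun v => f v * g v) := by
  obtain ⟨s, t, e, hs, ht⟩ := hf.common hg
  exact ⟨.mul s t, e, fun v => by beta_reduce; rw [hs, ht]; rfl⟩

theorem IsTerm.succ {f : (ℕ → M) → M} (hf : IsTerm f) : IsTerm (fun v => f v + 1) :=
  hf.add (.const 1)

theorem IsTerm.pair {f g : (ℕ → M) → M} (hf : IsTerm f) (hg : IsTerm g) :
    IsTerm (fun v => pair (f v) (g v)) :=
  ((hf.add hg).mul (hf.add hg)).add hf

theorem IsTerm.comp_succ {f : (ℕ → M) → M} (hf : IsTerm f) :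
    IsTerm (fun v => f fun k => v (k + 1)) := by
  obtain ⟨t, e, ht⟩ := hf
  refine ⟨t.rename fun k => if k % 2 = 0 then k + 2 else k, e, fun v => ?_⟩
  beta_reduce
  rw [ht, NumTerm.val_rename]
  congr 1
  funext k
  by_cases hk : k % 2 = 0 <;> simp [mix, hk]

/-! ### Closure properties of `Σ⁰₀` predicates. -/

namespace IsBdd

variable {P Q : (ℕ → M) → Prop} {f g : (ℕ → M) → M}

theorem mem {X : Set M} (hX : X ∈ S) (hf : IsTerm f) : IsBdd S (fun v => f v ∈ X) := by
  obtain ⟨t, e, ht⟩ := hf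
  exact ⟨.mem t 0, e, fun _ => X, fun _ => hX, fun v => by beta_reduce; rw [ht]; rfl⟩

theorem not (hP : IsBdd S P) : IsBdd S (fun v => ¬ P v) := by
  obtain ⟨θ, e, E, hE, hθ⟩ := hP
  exact ⟨.neg θ, e, E, hE, fun v => by beta_reduce; rw [hθ]; rfl⟩

theorem and (hP : IsBdd S P) (hQ : IsBdd S Q) : IsBdd S (fun v => P v ∧ Q v) := by
  obtain ⟨θ, η, e, E, hE, hθ, hη⟩ := hP.common hQ
  exact ⟨.and θ η, e, E, hE, fun v => by beta_reduce; rw [hθ, hη]; rfl⟩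

theorem or (hP : IsBdd S P) (hQ : IsBdd S Q) : IsBdd S (fun v => P v ∨ Q v) := by
  obtain ⟨θ, η, e, E, hE, hθ, hη⟩ := hP.common hQ
  exact ⟨.or θ η, e, E, hE, fun v => by beta_reduce; rw [hθ, hη]; rfl⟩

theorem congr (hP : IsBdd S P) (h : ∀ v, Q v ↔ P v) : IsBdd S Q := by
  rwa [show Q = P from funext fun v => propext (h v)]

theorem imp (hP : IsBdd S P) (hQ : IsBdd S Q) : IsBdd S (fun v => P v → Q v) :=
  (hP.not.or hQ).congr fun _ => imp_iff_not_or

theorem iff (hP : IsBdd S P) (hQ : IsBdd S Q) : IsBdd S (fun v => P v ↔ Q v) :=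
  ((hP.imp hQ).and (hQ.imp hP)).congr fun _ => iff_iff_implies_and_implies

theorem bex {P : (ℕ → M) → M → Prop} (hf : IsTerm f)
    (hP : IsBdd S (fun v => P (fun k => v (k + 1)) (v 0))) :
    IsBdd S (fun v => ∃ x, x < f v ∧ P v x) := by
  obtain ⟨t, θ, e, E, hE, ht, hθ⟩ := hf.common_isBdd hP
  refine ⟨.bex t (θ.rename id fun k => if k = 0 then 0 else if k % 2 = 0 then k - 1 else k + 1),
    e, E, hE, fun v => ?_⟩
  simp only [BddFormula.Holds, BddFormula.holds_rename, mix_cons, Function.comp_id, ht v, ← hθ]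
  rfl

theorem ball {P : (ℕ → M) → M → Prop} (hf : IsTerm f)
    (hP : IsBdd S (fun v => P (fun k => v (k + 1)) (v 0))) :
    IsBdd S (fun v => ∀ x, x < f v → P v x) :=
  (bex (P := fun v x => ¬ P v x) hf hP.not).not.congr fun v => by simp

theorem rename (hP : IsBdd S P) (r : ℕ → ℕ) : IsBdd S (fun v => P (v ∘ r)) := by
  obtain ⟨θ, e, E, hE, hθ⟩ := hP
  refine ⟨θ.rename id fun k => if k % 2 = 0 then 2 * r (k / 2) else k, e, E, hE, fun v => ?_⟩
  beta_reduce
  rw [hθ, BddFormula.holds_rename, Function.comp_id]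
  suffices h : mix (v ∘ r) e = mix v e ∘ fun k => if k % 2 = 0 then 2 * r (k / 2) else k by rw [h]
  funext k
  by_cases hk : k % 2 = 0 <;> simp [mix, hk]

/-- A formula whose first three variables are replaced by given variables. -/
theorem holds_cons₃ (θ : BddFormula) (e : ℕ → M) {E : ℕ → Set M} (hE : ∀ i, E i ∈ S)
    (i j k : ℕ) : IsBdd S (fun v => θ.Holds E (cons (v i) (cons (v j) (cons (v k) e)))) := by
  refine ⟨θ.rename id fun n => if n = 0 then 2 * i else if n = 1 then 2 * j else
    if n = 2 then 2 * k else 2 * (n - 3) + 1, e, E, hE, fun v => ?_⟩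
  rw [BddFormula.holds_rename, Function.comp_id]
  refine iff_of_eq (congrArg _ (funext fun n => ?_))
  match n with
  | 0 => simp [mix, cons]
  | 1 => simp [mix, cons]
  | 2 => simp [mix, cons]
  | n + 3 =>
    have h1 : (2 * n + 1) % 2 = 1 := by omega
    have h2 : (2 * n + 1) / 2 = n := by omega
    simp [mix, cons, h1, h2]

theorem exists_formula {P : M → M → Prop} (hP : IsBdd S (fun v => P (v 1) (v 0))) :
    ∃ (θ : BddFormula) (e : ℕ → M) (E : ℕ → Set M), (∀ i, E i ∈ S) ∧
      ∀ x m, P x m ↔ θ.Holds E (cons m (cons x e)) := by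
  obtain ⟨θ, e, E, hE, hθ⟩ := hP
  -- All variables beyond the first are read as `x`, which is harmless because `P` looks only at
  -- variables `0` and `1`.
  refine ⟨θ.rename id fun k => if k = 0 then 0 else if k % 2 = 0 then 1 else k / 2 + 2,
    e, E, hE, fun x m => ?_⟩
  rw [BddFormula.holds_rename, Function.comp_id]
  have h := hθ (fun k => if k = 0 then m else x)
  simp only [one_ne_zero, if_false, if_true] at h
  rw [h]
  refine iff_of_eq (congrArg _ (funext fun n => ?_))
  rcases Nat.even_or_odd' n with ⟨c, rfl | rfl⟩
  · cases c with
    | zero => simp [mix, cons]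
    | succ c => simp [mix, cons]
  · have h1 : (2 * c + 1) % 2 = 1 := by omega
    have h2 : (2 * c + 1) / 2 = c := by omega
    simp [mix, cons, h1, h2]

theorem isSigma01 {P : M → M → Prop} (hP : IsBdd S (fun v => P (v 1) (v 0))) :
    IsSigma01 S {x | ∃ m, P x m} := by
  obtain ⟨θ, e, E, hE, h⟩ := hP.exists_formula
  exact ⟨θ, e, E, hE, fun x => exists_congr (h x)⟩

theorem isPi01 {P : M → M → Prop} (hP : IsBdd S (fun v => P (v 1) (v 0))) :
    IsPi01 S {x | ∀ m, P x m} := by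
  obtain ⟨θ, e, E, hE, h⟩ := hP.exists_formula
  exact ⟨θ, e, E, hE, fun x => forall_congr' (h x)⟩

theorem isPi02 {T : M → M → M → Prop} (hT : IsBdd S (fun v => T (v 2) (v 1) (v 0))) :
    IsPi02 S {x | ∀ m, ∃ n, T x m n} := by
  obtain ⟨θ, e, E, hE, hθ⟩ := hT
  refine ⟨θ.rename id fun k => if k % 2 = 0 then min (k / 2) 2 else k / 2 + 3, e, E, hE,
    fun x => forall_congr' fun m => exists_congr fun n => ?_⟩
  rw [BddFormula.holds_rename, Function.comp_id]
  refine (hθ (fun k => cons n (cons m (cons x e)) (min k 2))).trans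
    (iff_of_eq (congrArg _ (funext fun k => ?_)))
  rcases Nat.even_or_odd' k with ⟨c, rfl | rfl⟩
  · simp [mix]
  · have h1 : (2 * c + 1) % 2 = 1 := by omega
    have h2 : (2 * c + 1) / 2 = c := by omega
    simp [mix, cons, h1, h2]

end IsBdd

variable {f g : (ℕ → M) → M}

theorem IsModelRCA0.isBdd_eq (hM : IsModelRCA0 S) (hf : IsTerm f) (hg : IsTerm g) :
    IsBdd S (fun v => f v = g v) := by
  obtain ⟨s, t, e, hs, ht⟩ := hf.common hg
  obtain ⟨X, hX⟩ := hM.sets_nonempty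
  exact ⟨.eq s t, e, fun _ => X, fun _ => hX, fun v => by beta_reduce; rw [hs, ht]; rfl⟩

theorem IsModelRCA0.isBdd_lt (hM : IsModelRCA0 S) (hf : IsTerm f) (hg : IsTerm g) :
    IsBdd S (fun v => f v < g v) := by
  obtain ⟨s, t, e, hs, ht⟩ := hf.common hg
  obtain ⟨X, hX⟩ := hM.sets_nonempty
  exact ⟨.lt s t, e, fun _ => X, fun _ => hX, fun v => by beta_reduce; rw [hs, ht]; rfl⟩

/-- `Σ⁰₁` induction. -/
theorem IsModelRCA0.sigma_induction (hM : IsModelRCA0 S) {P : M → M → Prop}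
    (hP : IsBdd S (fun v => P (v 1) (v 0))) (h0 : ∃ m, P 0 m)
    (h1 : ∀ n, (∃ m, P n m) → ∃ m, P (n + 1) m) (n : M) : ∃ m, P n m :=
  hM.sigma01_induction _ hP.isSigma01 h0 h1 n

/-- `Σ⁰₀` induction. -/
theorem IsModelRCA0.bdd_induction (hM : IsModelRCA0 S) {P : M → Prop}
    (hP : IsBdd S (fun v => P (v 0))) (h0 : P 0) (h1 : ∀ n, P n → P (n + 1)) (n : M) : P n := by
  obtain ⟨-, h⟩ := hM.sigma_induction (P := fun x _ => P x) (hP.rename fun _ => 1) ⟨0, h0⟩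
    (fun n ⟨m, h⟩ => ⟨m, h1 n h⟩) n
  exact h

end Definability

/-! ### The ordered semiring of a model -/

section Arithmetic

variable {M : Type u} [ArithStructure M] {S : Set (Set M)}

namespace IsModelRCA0

theorem zero_add (hM : IsModelRCA0 S) (n : M) : 0 + n = n :=
  hM.bdd_induction (P := fun n => 0 + n = n)
    (hM.isBdd_eq ((IsTerm.const 0).add (.var 0)) (.var 0)) (hM.add_zero 0)
    (fun n h => by rw [hM.add_succ, h]) n

theorem succ_add (hM : IsModelRCA0 S) (m n : M) : m + 1 + n = m + n + 1 :=
  hM.bdd_induction (P := fun n => m + 1 + n = m + n + 1)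
    (hM.isBdd_eq ((IsTerm.const _).add (.var 0)) ((IsTerm.const m).add (.var 0)).succ)
    (by rw [hM.add_zero, hM.add_zero]) (fun n h => by rw [hM.add_succ, h, hM.add_succ]) n

theorem add_comm (hM : IsModelRCA0 S) (m n : M) : m + n = n + m :=
  hM.bdd_induction (P := fun n => m + n = n + m)
    (hM.isBdd_eq ((IsTerm.const m).add (.var 0)) ((IsTerm.var 0).add (.const m)))
    (by rw [hM.add_zero, hM.zero_add]) (fun n h => by rw [hM.add_succ, h, hM.succ_add]) n

theorem add_assoc (hM : IsModelRCA0 S) (a b c : M) : a + b + c = a + (b + c) :=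
  hM.bdd_induction (P := fun c => a + b + c = a + (b + c))
    (hM.isBdd_eq ((IsTerm.const (a + b)).add (.var 0))
      ((IsTerm.const a).add ((IsTerm.const b).add (.var 0))))
    (by rw [hM.add_zero, hM.add_zero])
    (fun c h => by rw [hM.add_succ, h, hM.add_succ, hM.add_succ]) c

theorem add_right_cancel (hM : IsModelRCA0 S) {a b c : M} (h : a + c = b + c) : a = b := by
  revert h
  exact hM.bdd_induction (P := fun c => a + c = b + c → a = b)
    ((hM.isBdd_eq ((IsTerm.const a).add (.var 0)) ((IsTerm.const b).add (.var 0))).imp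
      (hM.isBdd_eq (.const a) (.const b)))
    (by rw [hM.add_zero, hM.add_zero]; exact id)
    (fun c h h' => h (hM.succ_inj _ _ (by rwa [hM.add_succ, hM.add_succ] at h'))) c

theorem zero_mul (hM : IsModelRCA0 S) (n : M) : 0 * n = 0 :=
  hM.bdd_induction (P := fun n => 0 * n = 0)
    (hM.isBdd_eq ((IsTerm.const 0).mul (.var 0)) (.const 0)) (hM.mul_zero 0)
    (fun n h => by rw [hM.mul_succ, h, hM.add_zero]) n

theorem succ_mul (hM : IsModelRCA0 S) (m n : M) : (m + 1) * n = m * n + n :=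
  hM.bdd_induction (P := fun n => (m + 1) * n = m * n + n)
    (hM.isBdd_eq ((IsTerm.const _).mul (.var 0)) (((IsTerm.const m).mul (.var 0)).add (.var 0)))
    (by rw [hM.mul_zero, hM.mul_zero, hM.add_zero])
    (fun n h => by
      rw [hM.mul_succ, h, hM.mul_succ, hM.add_assoc, hM.add_assoc (m * n), hM.add_succ n m,
        hM.add_succ m n, hM.add_comm n m]) n

theorem mul_comm (hM : IsModelRCA0 S) (m n : M) : m * n = n * m :=
  hM.bdd_induction (P := fun n => m * n = n * m)
    (hM.isBdd_eq ((IsTerm.const m).mul (.var 0)) ((IsTerm.var 0).mul (.const m)))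
    (by rw [hM.mul_zero, hM.zero_mul]) (fun n h => by rw [hM.mul_succ, h, hM.succ_mul]) n

theorem mul_add (hM : IsModelRCA0 S) (a b c : M) : a * (b + c) = a * b + a * c :=
  hM.bdd_induction (P := fun c => a * (b + c) = a * b + a * c)
    (hM.isBdd_eq ((IsTerm.const a).mul ((IsTerm.const b).add (.var 0)))
      ((IsTerm.const (a * b)).add ((IsTerm.const a).mul (.var 0))))
    (by rw [hM.add_zero, hM.mul_zero, hM.add_zero])
    (fun c h => by rw [hM.add_succ, hM.mul_succ, h, hM.mul_succ, hM.add_assoc]) c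

theorem mul_assoc (hM : IsModelRCA0 S) (a b c : M) : a * b * c = a * (b * c) :=
  hM.bdd_induction (P := fun c => a * b * c = a * (b * c))
    (hM.isBdd_eq ((IsTerm.const (a * b)).mul (.var 0))
      ((IsTerm.const a).mul ((IsTerm.const b).mul (.var 0))))
    (by rw [hM.mul_zero, hM.mul_zero, hM.mul_zero])
    (fun c h => by rw [hM.mul_succ, h, hM.mul_succ, hM.mul_add]) c

theorem mul_one (hM : IsModelRCA0 S) (a : M) : a * 1 = a := by
  rw [← hM.zero_add 1, hM.mul_succ, hM.mul_zero, hM.zero_add]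

theorem eq_zero_or_exists_eq_succ (hM : IsModelRCA0 S) (n : M) : n = 0 ∨ ∃ m, n = m + 1 := by
  obtain ⟨m, h⟩ := hM.sigma_induction (P := fun n m => n = 0 ∨ n = m + 1)
    ((hM.isBdd_eq (.var 1) (.const 0)).or (hM.isBdd_eq (.var 1) (IsTerm.var 0).succ))
    ⟨0, .inl rfl⟩ (fun n _ => ⟨n, .inr rfl⟩) n
  exact h.imp_right fun h => ⟨m, h⟩

theorem lt_add_succ (hM : IsModelRCA0 S) (a c : M) : a < a + (c + 1) :=
  hM.bdd_induction (P := fun c => a < a + (c + 1))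
    (hM.isBdd_lt (.const a) ((IsTerm.const a).add (IsTerm.var 0).succ))
    (by rw [hM.add_succ, hM.add_zero, hM.lt_succ]; exact .inr rfl)
    (fun c h => by rw [hM.add_succ, hM.lt_succ]; exact .inl h) c

/-- This ties the order, known only through its recursion on the right argument, to addition. The
difference is an unbounded witness, so the induction is `Σ⁰₁`. -/
theorem lt_iff_exists (hM : IsModelRCA0 S) (a b : M) : a < b ↔ ∃ c, b = a + (c + 1) := by
  refine ⟨fun h => ?_, ?_⟩
  · obtain ⟨c, hc⟩ := hM.sigma_induction (P := fun b c => a < b → b = a + (c + 1))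
      ((hM.isBdd_lt (.const a) (.var 1)).imp
        (hM.isBdd_eq (.var 1) ((IsTerm.const a).add (IsTerm.var 0).succ)))
      ⟨0, fun h => (hM.not_lt_zero _ h).elim⟩
      (fun b ⟨c, hc⟩ => by
        by_cases hb : a < b
        · exact ⟨c + 1, fun _ => by rw [hM.add_succ, ← hc hb]⟩
        · refine ⟨0, fun h => ?_⟩
          rw [((hM.lt_succ _ _).1 h).resolve_left hb, hM.zero_add]) b
    exact ⟨c, hc h⟩
  · rintro ⟨c, rfl⟩
    exact hM.lt_add_succ a c

theorem lt_irrefl (hM : IsModelRCA0 S) (a : M) : ¬ a < a := fun h => by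
  obtain ⟨c, hc⟩ := (hM.lt_iff_exists a a).1 h
  refine hM.succ_ne_zero c (hM.add_right_cancel (c := a) ?_)
  rw [hM.zero_add, hM.add_comm, ← hc]

theorem lt_trans (hM : IsModelRCA0 S) {a b c : M} (h : a < b) (h' : b < c) : a < c := by
  obtain ⟨d, rfl⟩ := (hM.lt_iff_exists a b).1 h
  obtain ⟨e, rfl⟩ := (hM.lt_iff_exists _ c).1 h'
  rw [hM.add_assoc, hM.add_succ]
  exact hM.lt_add_succ _ _

theorem lt_trichotomy (hM : IsModelRCA0 S) (a b : M) : a < b ∨ a = b ∨ b < a := by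
  refine hM.bdd_induction (P := fun b => a < b ∨ a = b ∨ b < a)
    ((hM.isBdd_lt (.const a) (.var 0)).or
      ((hM.isBdd_eq (.const a) (.var 0)).or (hM.isBdd_lt (.var 0) (.const a)))) ?_ ?_ b
  · rcases hM.eq_zero_or_exists_eq_succ a with rfl | ⟨m, rfl⟩
    · exact .inr (.inl rfl)
    · exact .inr (.inr ((hM.lt_iff_exists _ _).2 ⟨m, (hM.zero_add _).symm⟩))
  · rintro b (h | rfl | h)
    · exact .inl ((hM.lt_succ _ _).2 (.inl h))
    · exact .inl ((hM.lt_succ _ _).2 (.inr rfl))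
    · obtain ⟨c, rfl⟩ := (hM.lt_iff_exists _ _).1 h
      rcases hM.eq_zero_or_exists_eq_succ c with rfl | ⟨m, rfl⟩
      · exact .inr (.inl (by rw [hM.zero_add]))
      · exact .inr (.inr ((hM.lt_iff_exists _ _).2 ⟨m, by
          rw [hM.add_succ b (m + 1), hM.succ_add]⟩))

end IsModelRCA0

/-- `M` is the first order part of a model of `RCA₀`. -/
class IsFirstOrderPart (M : Type u) [ArithStructure M] : Prop where
  exists_isModelRCA0 : ∃ S : Set (Set M), IsModelRCA0 S

variable [IsFirstOrderPart M]

/-- The operations are the given ones, so that algebraic lemmas apply directly to values of terms;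
`S` is hidden in the class because an instance cannot take it as an argument. -/
instance : CommSemiring M :=
  have hM : IsModelRCA0 (Classical.choose (IsFirstOrderPart.exists_isModelRCA0 (M := M))) :=
    Classical.choose_spec IsFirstOrderPart.exists_isModelRCA0
  { add := (· + ·)
    zero := 0
    mul := (· * ·)
    one := 1
    add_assoc := hM.add_assoc
    zero_add := hM.zero_add
    add_zero := hM.add_zero
    add_comm := hM.add_comm
    mul_assoc := hM.mul_assoc
    mul_comm := hM.mul_comm
    zero_mul := hM.zero_mul
    mul_zero := hM.mul_zero
    left_distrib := hM.mul_add
    right_distrib := fun a b c => by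
      change (a + b) * c = a * c + b * c
      rw [hM.mul_comm, hM.mul_add, hM.mul_comm c, hM.mul_comm c]
    one_mul := fun a => (hM.mul_comm 1 a).trans (hM.mul_one a)
    mul_one := hM.mul_one
    nsmul := nsmulRec }

noncomputable instance : LinearOrder M :=
  have hM : IsModelRCA0 (Classical.choose (IsFirstOrderPart.exists_isModelRCA0 (M := M))) :=
    Classical.choose_spec IsFirstOrderPart.exists_isModelRCA0
  { lt := (· < ·)
    le := fun a b => a < b ∨ a = b
    le_refl := fun _ => .inr rfl
    le_trans := by
      rintro a b c (h | rfl) (h' | rfl)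
      exacts [.inl (hM.lt_trans h h'), .inl h, .inl h', .inr rfl]
    le_antisymm := by
      rintro a b (h | rfl) (h' | h')
      exacts [(hM.lt_irrefl _ (hM.lt_trans h h')).elim, h'.symm, rfl, rfl]
    lt_iff_le_not_ge := fun a b => by
      refine ⟨fun h => ⟨.inl h, ?_⟩, ?_⟩
      · rintro (h' | rfl)
        exacts [hM.lt_irrefl _ (hM.lt_trans h h'), hM.lt_irrefl _ h]
      · rintro ⟨h | rfl, h'⟩
        exacts [h, (h' (.inr rfl)).elim]
    le_total := fun a b => by
      rcases hM.lt_trichotomy a b with h | rfl | h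
      exacts [.inl (.inl h), .inl (.inr rfl), .inr (.inl h)]
    toDecidableLE := Classical.decRel _ }

theorem IsFirstOrderPart.le_iff (a b : M) : a ≤ b ↔ a < b ∨ a = b := Iff.rfl

theorem IsFirstOrderPart.lt_iff_exists (a b : M) : a < b ↔ ∃ c, b = a + (c + 1) :=
  (Classical.choose_spec (IsFirstOrderPart.exists_isModelRCA0 (M := M))).lt_iff_exists a b

theorem IsFirstOrderPart.le_iff_exists (a b : M) : a ≤ b ↔ ∃ c, b = a + c := by
  have hM := Classical.choose_spec (IsFirstOrderPart.exists_isModelRCA0 (M := M))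
  constructor
  · rintro (h | rfl)
    · obtain ⟨c, rfl⟩ := (hM.lt_iff_exists _ _).1 h
      exact ⟨_, rfl⟩
    · exact ⟨0, (add_zero _).symm⟩
  · rintro ⟨c, rfl⟩
    rcases hM.eq_zero_or_exists_eq_succ c with rfl | ⟨m, rfl⟩
    · exact .inr (add_zero _).symm
    · exact .inl (hM.lt_add_succ _ _)

instance : CanonicallyOrderedAdd M where
  exists_add_of_le := fun h => (IsFirstOrderPart.le_iff_exists _ _).1 h
  le_add_self := fun _ b => (IsFirstOrderPart.le_iff_exists _ _).2 ⟨b, add_comm _ _⟩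
  le_self_add := fun _ b => (IsFirstOrderPart.le_iff_exists _ _).2 ⟨b, rfl⟩

instance : IsStrictOrderedRing M :=
  have hM := Classical.choose_spec (IsFirstOrderPart.exists_isModelRCA0 (M := M))
  have hadd : ∀ a b : M, a ≤ b → ∀ c, c + a ≤ c + b := fun a b h c => by
    obtain ⟨d, rfl⟩ := (IsFirstOrderPart.le_iff_exists _ _).1 h
    exact (IsFirstOrderPart.le_iff_exists _ _).2 ⟨d, (add_assoc _ _ _).symm⟩
  have hmul : ∀ a b c : M, 0 < a → b < c → a * b < a * c := fun a b c ha h => by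
    obtain ⟨d, rfl⟩ := (IsFirstOrderPart.lt_iff_exists _ _).1 h
    obtain ⟨e, rfl⟩ := (IsFirstOrderPart.lt_iff_exists _ _).1 ha
    exact (IsFirstOrderPart.lt_iff_exists _ _).2 ⟨e * d + e + d, by ring⟩
  { add_le_add_left := fun a b h c => by simpa only [add_comm c] using hadd a b h c
    le_of_add_le_add_left := fun a b c h => by
      obtain ⟨d, hd⟩ := (IsFirstOrderPart.le_iff_exists _ _).1 h
      refine (IsFirstOrderPart.le_iff_exists _ _).2 ⟨d, hM.add_right_cancel (c := a) ?_⟩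
      rw [add_comm, hd]; ring
    zero_le_one := zero_le
    exists_pair_ne := ⟨0 + 1, 0, hM.succ_ne_zero 0⟩
    mul_lt_mul_of_pos_left := fun _ ha _ _ h => hmul _ _ _ ha h
    mul_lt_mul_of_pos_right := fun a ha b c h => by
      simpa only [mul_comm a] using hmul a b c ha h }

theorem IsFirstOrderPart.lt_succ (a b : M) : a < b + 1 ↔ a ≤ b :=
  (Classical.choose_spec (IsFirstOrderPart.exists_isModelRCA0 (M := M))).lt_succ a b

end Arithmetic

/-! ### Least elements, bounding and coding of bounded sets -/

section Coding

variable {M : Type u} [ArithStructure M] [IsFirstOrderPart M] {S : Set (Set M)}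

theorem IsFirstOrderPart.one_le_iff {a : M} : 1 ≤ a ↔ a ≠ 0 := by
  rw [← pos_iff_ne_zero, ← IsFirstOrderPart.lt_succ, lt_add_iff_pos_left]

theorem IsFirstOrderPart.le_mul_self (a : M) : a ≤ a * a := by
  rcases eq_or_ne a 0 with rfl | h
  · rw [mul_zero]
  · exact le_mul_of_one_le_left zero_le (IsFirstOrderPart.one_le_iff.2 h)

theorem IsFirstOrderPart.le_mul_left {a b : M} (h : b ≠ 0) : a ≤ b * a :=
  le_mul_of_one_le_left zero_le (IsFirstOrderPart.one_le_iff.2 h)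

theorem left_le_pair (i j : M) : i ≤ pair i j := le_add_self

theorem right_le_pair (i j : M) : j ≤ pair i j :=
  (le_add_self.trans (IsFirstOrderPart.le_mul_self (i + j))).trans le_self_add

/-- `pair i j` lies between `(i + j)²` and `(i + j + 1)²`, so it determines the sum. -/
theorem add_le_add_of_pair_le {i j i' j' : M} (h : pair i j ≤ pair i' j') : i + j ≤ i' + j' := by
  by_contra! hlt
  refine h.not_gt ?_
  have h1 : i' + j' + 1 ≤ i + j := by rwa [← IsFirstOrderPart.lt_succ, add_lt_add_iff_right]
  calc pair i' j' ≤ (i' + j') * (i' + j') + (i' + j') := by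
        unfold pair; gcongr; exact le_self_add
    _ < (i' + j' + 1) * (i' + j' + 1) := by
        rw [IsFirstOrderPart.lt_iff_exists]; exact ⟨i' + j', by ring⟩
    _ ≤ (i + j) * (i + j) := mul_le_mul' h1 h1
    _ ≤ pair i j := le_self_add

theorem pair_inj {i j i' j' : M} (h : pair i j = pair i' j') : i = i' ∧ j = j' := by
  have h1 : i + j = i' + j' := le_antisymm (add_le_add_of_pair_le h.le) (add_le_add_of_pair_le h.ge)
  have h2 : i = i' := by
    unfold pair at h
    rw [h1] at h
    exact add_left_cancel h
  subst h2
  exact ⟨rfl, add_left_cancel h1⟩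

/-- There is no subtraction, so the quotients are compared; if `q ≤ p`, then `b = 0`. -/
theorem IsFirstOrderPart.dvd_of_dvd_add {d a b : M} (h : d ∣ a) (h' : d ∣ a + b) : d ∣ b := by
  obtain ⟨p, rfl⟩ := h
  obtain ⟨q, hq⟩ := h'
  rcases le_total p q with hpq | hpq <;> obtain ⟨r, rfl⟩ := (le_iff_exists _ _).1 hpq
  · exact ⟨r, add_left_cancel (a := d * p) (by rw [hq, mul_add])⟩
  · have h0 : d * r + b = 0 := add_left_cancel (a := d * q) (by
      rw [add_zero, ← add_assoc, ← mul_add, hq])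
    rw [(add_eq_zero.1 h0).2]
    exact dvd_zero d

/-- `m * k + 1` is coprime to `m`, hence to `δ`: if it divides `m * y`, then it divides `m * k * y`,
and so also `y`. -/
theorem IsFirstOrderPart.dvd_of_dvd_mul_mul {m k δ x : M} (hδ : δ ∣ m)
    (h : m * k + 1 ∣ m * δ * x) : m * k + 1 ∣ x := by
  have key : ∀ y, m * k + 1 ∣ m * y → m * k + 1 ∣ y := fun y hy => by
    refine dvd_of_dvd_add (a := m * k * y) ?_ ⟨y, by ring⟩
    rw [mul_right_comm]
    exact hy.mul_right k
  have h1 : m * k + 1 ∣ δ * x := key _ (by rwa [← mul_assoc])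
  obtain ⟨q, hq⟩ := hδ
  refine key _ ?_
  convert h1.mul_right q using 1
  rw [hq, mul_right_comm]

/-- The moduli `m * (i + 1) + 1` are coprime in pairs if `m` has many divisors. -/
theorem IsFirstOrderPart.dvd_of_dvd_mul_modulus {l m i j x : M} (hm : ∀ i, i < l → i + 1 ∣ m)
    (hi : i < l) (hj : j < l) (hij : i ≠ j) (h : m * (i + 1) + 1 ∣ (m * (j + 1) + 1) * x) :
    m * (i + 1) + 1 ∣ x := by
  rcases hij.lt_or_gt with hlt | hlt <;> obtain ⟨δ, rfl⟩ := (lt_iff_exists _ _).1 hlt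
  · have hδ : δ < l := lt_of_le_of_lt (le_self_add.trans le_add_self) hj
    refine dvd_of_dvd_mul_mul (hm δ hδ) (dvd_of_dvd_add (Dvd.intro x rfl) ?_)
    convert h using 1
    ring
  · have hδ : δ < l := lt_of_le_of_lt (le_self_add.trans le_add_self) hi
    refine dvd_of_dvd_mul_mul (hm δ hδ) (dvd_of_dvd_add h ?_)
    refine ⟨x, ?_⟩
    ring

variable {f g h : (ℕ → M) → M}

namespace IsModelRCA0

theorem isBdd_le (hM : IsModelRCA0 S) (hf : IsTerm f) (hg : IsTerm g) :
    IsBdd S (fun v => f v ≤ g v) :=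
  (hM.isBdd_lt hf hg).or (hM.isBdd_eq hf hg)

theorem isBdd_dvd (hM : IsModelRCA0 S) (hf : IsTerm f) (hg : IsTerm g) :
    IsBdd S (fun v => f v ∣ g v) := by
  refine IsBdd.congr (IsBdd.bex (P := fun v q => g v = f v * q) hg.succ
    (hM.isBdd_eq (hg.comp_succ) (hf.comp_succ.mul (.var 0)))) fun v => ?_
  constructor
  · rintro ⟨q, hq⟩
    -- A quotient by a nonzero number is at most the dividend; for divisor `0` the quotient is
    -- arbitrary and `0` is chosen.
    by_cases h0 : f v = 0
    · exact ⟨0, by rw [IsFirstOrderPart.lt_succ]; exact zero_le, by rw [hq, h0, MulZeroClass.zero_mul, MulZeroClass.zero_mul]⟩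
    · exact ⟨q, by rw [IsFirstOrderPart.lt_succ, hq]; exact IsFirstOrderPart.le_mul_left h0, hq⟩
  · rintro ⟨q, -, hq⟩
    exact ⟨q, hq⟩

theorem isBdd_bit (hM : IsModelRCA0 S) (hf : IsTerm f) (hg : IsTerm g) (hh : IsTerm h) :
    IsBdd S (fun v => Bit (f v) (g v) (h v)) :=
  hM.isBdd_dvd (hf.mul hh.succ).succ hg

/-- Competing pairs matter only below `pair m n`, and this bounds both of their components. -/
theorem isBdd_isCode (hM : IsModelRCA0 S) {k : (ℕ → M) → M} (hk : IsTerm k) (hf : IsTerm f)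
    (hg : IsTerm g) (hh : IsTerm h) : IsBdd S (fun v => IsCode (k v) (f v) (g v) (h v)) := by
  have key := (hM.isBdd_eq hk (hf.pair (hg.pair hh))).and (IsBdd.ball (hg.pair hh)
    (P := fun v m' => ∀ n', n' < pair (g v) (h v) →
      (∀ i, i < f v → (Bit m' n' i ↔ Bit (g v) (h v) i)) → ¬ pair m' n' < pair (g v) (h v))
    (IsBdd.ball (hg.pair hh).comp_succ (.imp (.ball hf.comp_succ.comp_succ
        (.iff (hM.isBdd_bit (.var 2) (.var 1) (.var 0))
          (hM.isBdd_bit hg.comp_succ.comp_succ.comp_succ hh.comp_succ.comp_succ.comp_succ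
            (.var 0))))
      (hM.isBdd_lt (.pair (.var 1) (.var 0)) (hg.pair hh).comp_succ.comp_succ).not)))
  refine key.congr fun v => and_congr_right fun _ => ?_
  refine ⟨fun H m' _ n' _ => H m' n', fun H m' n' h1 h2 => ?_⟩
  exact H m' ((left_le_pair m' n').trans_lt h2) n' ((right_le_pair m' n').trans_lt h2) h1 h2

/-- The least number principle for `Σ⁰₀` predicates. -/
theorem exists_least (hM : IsModelRCA0 S) {P : M → Prop} (hP : IsBdd S (fun v => P (v 0)))
    (hex : ∃ x, P x) : ∃ x, P x ∧ ∀ y, y < x → ¬ P y := by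
  by_contra! hno
  obtain ⟨x, hx⟩ := hex
  refine hM.bdd_induction (P := fun n => ∀ y, y < n → ¬ P y)
    (.ball (.var 0) (hP.rename fun _ => 0).not) (fun y hy => (hM.not_lt_zero y hy).elim)
    (fun n hn y hy hPy => ?_) (x + 1) x (by rw [IsFirstOrderPart.lt_succ]) hx
  rcases (hM.lt_succ _ _).1 hy with h1 | rfl
  · exact hn y h1 hPy
  · obtain ⟨z, hz, hPz⟩ := hno y hPy
    exact hn z hz hPz

/-- The least number principle for `Π⁰₁` predicates. -/
theorem exists_least_pi (hM : IsModelRCA0 S) {P : M → M → Prop}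
    (hP : IsBdd S (fun v => P (v 1) (v 0))) (hex : ∃ x, ∀ m, P x m) :
    ∃ x, (∀ m, P x m) ∧ ∀ y, y < x → ¬ ∀ m, P y m := by
  by_contra! hno
  obtain ⟨x, hx⟩ := hex
  -- With no least solution, failure below `n` passes to `n`. One bound `B` for all the
  -- counterexamples makes the induction hypothesis `Σ⁰₁`.
  obtain ⟨B, hB⟩ := hM.sigma_induction (P := fun n B => ∀ y, y < n → ∃ m, m < B ∧ ¬ P y m)
    (.ball (.var 1) (.bex (.var 1) (hP.rename fun n => if n = 0 then 0 else 1).not))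
    ⟨0, fun y hy => (hM.not_lt_zero y hy).elim⟩
    (fun n ⟨B, hB⟩ => by
      have hn : ¬ ∀ m, P n m := fun hn => by
        obtain ⟨y, hy, hPy⟩ := hno n hn
        obtain ⟨m, -, hm⟩ := hB y hy
        exact hm (hPy m)
      push Not at hn
      obtain ⟨m, hm⟩ := hn
      refine ⟨max B (m + 1), fun y hy => ?_⟩
      rcases (hM.lt_succ _ _).1 hy with h1 | rfl
      · obtain ⟨k, hk, hk'⟩ := hB y h1
        exact ⟨k, lt_max_of_lt_left hk, hk'⟩
      · exact ⟨m, lt_max_of_lt_right (lt_add_one m), hm⟩) (x + 1)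
  obtain ⟨m, -, hm⟩ := hB x (lt_add_one x)
  exact hm (hx m)

/-- A finite set has a maximal element in a transitive relation. -/
theorem exists_maximal (hM : IsModelRCA0 S) {X : M → Prop} {R : M → M → Prop}
    (hX : IsBdd S (fun v => X (v 0))) (hR : IsBdd S (fun v => R (v 0) (v 1)))
    (irrefl : ∀ x, ¬ R x x) (trans : ∀ x y z, R x y → R y z → R x z) {u : M}
    (hex : ∃ x, x < u ∧ X x) : ∃ x, x < u ∧ X x ∧ ∀ y, y < u → X y → ¬ R x y := by
  revert hex
  refine hM.bdd_induction
    (P := fun u => (∃ x, x < u ∧ X x) → ∃ x, x < u ∧ X x ∧ ∀ y, y < u → X y → ¬ R x y)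
    (.imp (.bex (.var 0) (hX.rename fun _ => 0)) (.bex (.var 0) (.and (hX.rename fun _ => 0)
      (.ball (.var 1) (.imp (hX.rename fun _ => 0)
        (hR.rename fun n => if n = 0 then 1 else 0).not)))))
    (fun ⟨x, hx, _⟩ => (hM.not_lt_zero x hx).elim) (fun u ih hex => ?_) u
  by_cases hu : ∃ x, x < u ∧ X x
  · obtain ⟨x, hxu, hx, hmax⟩ := ih hu
    by_cases hcase : X u ∧ R x u
    · refine ⟨u, lt_add_one u, hcase.1, fun y hy hXy hR' => ?_⟩
      rcases (hM.lt_succ _ _).1 hy with h1 | rfl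
      · exact hmax y h1 hXy (trans _ _ _ hcase.2 hR')
      · exact irrefl _ hR'
    · refine ⟨x, hxu.trans (lt_add_one u), hx, fun y hy hXy hR' => ?_⟩
      rcases (hM.lt_succ _ _).1 hy with h1 | rfl
      · exact hmax y h1 hXy hR'
      · exact hcase ⟨hXy, hR'⟩
  · obtain ⟨x, hx, hXx⟩ := hex
    rcases (hM.lt_succ _ _).1 hx with h1 | rfl
    · exact (hu ⟨x, h1, hXx⟩).elim
    · refine ⟨x, hx, hXx, fun y hy hXy => ?_⟩
      rcases (hM.lt_succ _ _).1 hy with h1 | rfl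
      · exact (hu ⟨y, h1, hXy⟩).elim
      · exact irrefl _

/-- `Σ⁰₁` bounding. -/
theorem exists_bound (hM : IsModelRCA0 S) {P : M → M → Prop}
    (hP : IsBdd S (fun v => P (v 1) (v 0))) {a : M} (hex : ∀ i, i < a → ∃ m, P i m) :
    ∃ B, ∀ i, i < a → ∃ m, m < B ∧ P i m := by
  obtain ⟨B, hB⟩ := hM.sigma_induction
    (P := fun u B => u ≤ a → ∀ i, i < u → ∃ m, m < B ∧ P i m)
    (.imp (hM.isBdd_le (.var 1) (.const a))
      (.ball (.var 1) (.bex (.var 1) (hP.rename fun n => if n = 0 then 0 else 1))))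
    ⟨0, fun _ y hy => (hM.not_lt_zero y hy).elim⟩
    (fun u ⟨B, hB⟩ => by
      by_cases hu : u < a
      · obtain ⟨m, hm⟩ := hex u hu
        refine ⟨max B (m + 1), fun _ y hy => ?_⟩
        rcases (hM.lt_succ _ _).1 hy with h1 | rfl
        · obtain ⟨k, hk, hk'⟩ := hB hu.le y h1
          exact ⟨k, lt_max_of_lt_left hk, hk'⟩
        · exact ⟨m, lt_max_of_lt_right (lt_add_one m), hm⟩
      · exact ⟨0, fun hu' => (hu ((lt_add_one u).trans_le hu')).elim⟩) a
  exact ⟨B, hB le_rfl⟩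

theorem exists_common_multiple (hM : IsModelRCA0 S) {f : M → M}
    (hf : IsTerm (fun v => f (v 0))) (hf0 : ∀ i, f i ≠ 0) (l : M) :
    ∃ N : M, N ≠ 0 ∧ ∀ i, i < l → f i ∣ N :=
  hM.sigma_induction (P := fun l N => N ≠ 0 ∧ ∀ i, i < l → f i ∣ N)
    ((hM.isBdd_eq (.var 0) (.const 0)).not.and (.ball (.var 1) (hM.isBdd_dvd hf (.var 1))))
    ⟨1, one_ne_zero, fun y hy => (hM.not_lt_zero y hy).elim⟩
    (fun l ⟨N, hN, h⟩ => by
      refine ⟨N * f l, mul_ne_zero hN (hf0 l), fun i hi => ?_⟩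
      rcases (hM.lt_succ _ _).1 hi with h1 | rfl
      · exact (h i h1).mul_right _
      · exact dvd_mul_left _ _) l

/-- Bounded `Σ⁰₁` comprehension: the subsets of an initial segment are coded by bits, with a
bound on the codes. -/
theorem exists_code (hM : IsModelRCA0 S) (l : M) :
    ∃ m N : M, ∀ P : M → M → Prop, IsBdd S (fun v => P (v 1) (v 0)) →
      ∃ n, n < N ∧ ∀ i, i < l → (Bit m n i ↔ ∃ y, P i y) := by
  -- Since `m` is a multiple of `1, …, l`, the moduli `m * (i + 1) + 1` are pairwise coprime.
  obtain ⟨m, hm0, hm⟩ := hM.exists_common_multiple (f := fun i => i + 1) (IsTerm.var 0).succ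
    hM.succ_ne_zero l
  obtain ⟨N, hN0, hN⟩ := hM.exists_common_multiple (f := fun i => m * (i + 1) + 1)
    ((IsTerm.const m).mul (IsTerm.var 0).succ).succ (fun _ => hM.succ_ne_zero _) l
  refine ⟨m, N + 1, fun P hP => ?_⟩
  -- `n` is the least nonzero number divisible by the moduli of all `i` in the set. The condition is
  -- `Π⁰₁`, and `N` satisfies it whatever `P` is.
  obtain ⟨n, hn, hmin⟩ := hM.exists_least_pi
    (P := fun n y => n ≠ 0 ∧ ∀ i, i < l → P i y → m * (i + 1) + 1 ∣ n)
    ((hM.isBdd_eq (.var 1) (.const 0)).not.and (.ball (.const l)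
      (.imp (hP.rename fun k => if k = 0 then 1 else 0)
        (hM.isBdd_bit (.const m) (.var 2) (.var 0)))))
    ⟨N, fun y => ⟨hN0, fun i hi _ => hN i hi⟩⟩
  have hnN : n ≤ N := by
    by_contra! hlt
    exact hmin N hlt fun y => ⟨hN0, fun i hi _ => hN i hi⟩
  refine ⟨n, (IsFirstOrderPart.lt_succ _ _).2 hnN, fun j hj => ⟨fun hbit => ?_, ?_⟩⟩
  · by_contra hno
    obtain ⟨q, hq⟩ := hbit
    have hq0 : q ≠ 0 := by
      rintro rfl
      exact (hn 0).1 (by rw [hq, MulZeroClass.mul_zero])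
    -- A superfluous modulus could be divided out: the quotient is smaller and, by coprimality,
    -- still divisible by the required ones.
    refine hmin q ?_ fun y => ⟨hq0, fun i hi hiy => ?_⟩
    · rw [hq]
      refine lt_mul_of_one_lt_left (pos_iff_ne_zero.2 hq0) (lt_add_of_pos_left 1 ?_)
      exact mul_pos (pos_iff_ne_zero.2 hm0) (pos_iff_ne_zero.2 (hM.succ_ne_zero j))
    · refine IsFirstOrderPart.dvd_of_dvd_mul_modulus hm hi hj (fun h => hno ⟨y, h ▸ hiy⟩) ?_
      rw [← hq]
      exact (hn y).2 i hi hiy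
  · rintro ⟨y, hy⟩
    exact (hn y).2 j hj hy

/-- Strong `Σ⁰₁` bounding. -/
theorem exists_strong_bound (hM : IsModelRCA0 S) {P : M → M → Prop}
    (hP : IsBdd S (fun v => P (v 1) (v 0))) (a : M) :
    ∃ B, ∀ i, i < a → (∃ m, P i m) → ∃ m, m < B ∧ P i m := by
  -- Coding the set of `i` that have a witness makes the demand for one total, so ordinary bounding
  -- applies.
  obtain ⟨m, N, hcode⟩ := hM.exists_code a
  obtain ⟨n, -, hn⟩ := hcode P hP
  obtain ⟨B, hB⟩ := hM.exists_bound (P := fun i y => Bit m n i → P i y)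
    (.imp (hM.isBdd_bit (.const m) (.const n) (.var 1)) hP) (a := a)
    (fun i hi => by
      by_cases h : ∃ y, P i y
      · exact h.imp fun _ hy _ => hy
      · exact ⟨0, fun hb => (h ((hn i hi).1 hb)).elim⟩)
  refine ⟨B, fun i hi hex => ?_⟩
  obtain ⟨y, hy, hPy⟩ := hB i hi
  exact ⟨y, hy, hPy ((hn i hi).2 hex)⟩

end IsModelRCA0

end Coding

/-! ### Strings and the `Π⁰₂`-partition principle -/

section Strings

variable {M : Type u} [ArithStructure M] [IsFirstOrderPart M] {S : Set (Set M)}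

theorem IsCode.unique {s l m n l' m' n' : M} (h : IsCode s l m n) (h' : IsCode s l' m' n') :
    l = l' ∧ m = m' ∧ n = n' := by
  obtain ⟨h1, h2⟩ := pair_inj (h.1.symm.trans h'.1)
  exact ⟨h1, pair_inj h2⟩

theorem HasLength.unique {s l l' : M} (h : HasLength s l) (h' : HasLength s l') : l = l' := by
  obtain ⟨m, n, h⟩ := h
  obtain ⟨m', n', h'⟩ := h'
  exact (h.unique h').1

namespace IsModelRCA0

theorem setOf_mem (hM : IsModelRCA0 S) {P : M → Prop} (hP : IsBdd S (fun v => P (v 0))) :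
    {x | P x} ∈ S := by
  have h1 := (IsBdd.isSigma01 (P := fun x _ => P x) (hP.rename fun _ => 1))
  have h2 := (IsBdd.isPi01 (P := fun x _ => P x) (hP.rename fun _ => 1))
  simp only [exists_const] at h1
  simp only [forall_const] at h2
  exact hM.delta01_comprehension _ h1 h2

omit [IsFirstOrderPart M] in
/-- `Δ⁰₁` comprehension. -/
theorem setOf_exists_mem (hM : IsModelRCA0 S) {P Q : M → M → Prop}
    (hP : IsBdd S (fun v => P (v 1) (v 0))) (hQ : IsBdd S (fun v => Q (v 1) (v 0)))
    (h : ∀ x, (∃ m, P x m) ↔ ∀ m, Q x m) : {x | ∃ m, P x m} ∈ S := by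
  refine hM.delta01_comprehension _ hP.isSigma01 ?_
  simp only [h]
  exact hQ.isPi01

theorem exists_isCode (hM : IsModelRCA0 S) {P : M → Prop} (hP : IsBdd S (fun v => P (v 0)))
    (l : M) : ∃ s m n : M, IsCode s l m n ∧ ∀ i, i < l → (Bit m n i ↔ P i) := by
  obtain ⟨m, N, hcode⟩ := hM.exists_code l
  obtain ⟨n, -, hn⟩ := hcode (fun i _ => P i) (hP.rename fun _ => 1)
  simp only [exists_const] at hn
  obtain ⟨p, ⟨m', -, n', -, rfl, hbits⟩, hmin⟩ := hM.exists_least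
    (P := fun p => ∃ m, m < p + 1 ∧ ∃ n, n < p + 1 ∧ p = pair m n ∧
      ∀ i, i < l → (Bit m n i ↔ P i))
    (.bex (IsTerm.var 0).succ (.bex (IsTerm.var 1).succ (.and
      (hM.isBdd_eq (.var 2) (.pair (.var 1) (.var 0)))
      (.ball (.const l) (.iff (hM.isBdd_bit (.var 2) (.var 1) (.var 0)) (hP.rename fun _ => 0))))))
    ⟨pair m n, m, (IsFirstOrderPart.lt_succ _ _).2 (left_le_pair m n), n,
      (IsFirstOrderPart.lt_succ _ _).2 (right_le_pair m n), rfl, hn⟩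
  refine ⟨pair l (pair m' n'), m', n', ⟨rfl, fun m₁ n₁ h₁ hlt => ?_⟩, hbits⟩
  exact hmin _ hlt ⟨m₁, (IsFirstOrderPart.lt_succ _ _).2 (left_le_pair m₁ n₁), n₁,
    (IsFirstOrderPart.lt_succ _ _).2 (right_le_pair m₁ n₁), rfl,
    fun i hi => (h₁ i hi).trans (hbits i hi)⟩

/-- `RKLp` for the strings `C · s` of length `s`, where `C` is a `Σ⁰₀` predicate. -/
theorem exists_homogeneous_of_RKLp (hM : IsModelRCA0 S) (hR : RKLp S) {C : M → M → Prop}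
    (hC : IsBdd S (fun v => C (v 1) (v 0))) :
    ∃ H ∈ S, Unbounded H ∧ ((∀ b, ∃ s, b ≤ s ∧ ∀ x ∈ H, x < b → C x s) ∨
      ∀ b, ∃ s, b ≤ s ∧ ∀ x ∈ H, x < b → ¬ C x s) := by
  -- Exactly one string of each length `l`, with bit `C x l` at `x`.
  let A : Set M := {s | ∃ l, l < s + 1 ∧ ∃ m, m < s + 1 ∧ ∃ n, n < s + 1 ∧
    IsCode s l m n ∧ ∀ x, x < l → (Bit m n x ↔ C x l)}
  have hAS : A ∈ S := hM.setOf_mem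
    (.bex (IsTerm.var 0).succ (.bex (IsTerm.var 1).succ (.bex (IsTerm.var 2).succ (.and
      (hM.isBdd_isCode (.var 3) (.var 2) (.var 1) (.var 0))
      (.ball (.var 2) (.iff (hM.isBdd_bit (.var 2) (.var 1) (.var 0))
        (hC.rename fun k => if k = 0 then 3 else 0)))))))
  have hA : Unbounded A := fun b => by
    obtain ⟨s, m, n, hs, hbits⟩ := hM.exists_isCode (P := fun i => C i (b + 1))
      (by
        obtain ⟨l, hl⟩ : ∃ l, l = b + 1 := ⟨_, rfl⟩
        -- A constant is substituted for a variable by a bounded quantifier over the single value `y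
        -- = l`.
        refine (IsBdd.bex (P := fun v y => y = l ∧ C (v 0) y) (.const (l + 1))
          ((hM.isBdd_eq (.var 0) (.const l)).and hC)).congr fun v => ?_
        rw [← hl]
        exact ⟨fun h => ⟨l, lt_add_one l, rfl, h⟩, fun ⟨y, _, hy, h⟩ => hy ▸ h⟩) (b + 1)
    have h1 : b + 1 ≤ s := hs.1 ▸ left_le_pair _ _
    have h2 : pair m n ≤ s := hs.1 ▸ right_le_pair _ _
    refine ⟨s, ⟨b + 1, (IsFirstOrderPart.lt_succ _ _).2 h1, m,
      (IsFirstOrderPart.lt_succ _ _).2 ((left_le_pair _ _).trans h2), n,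
      (IsFirstOrderPart.lt_succ _ _).2 ((right_le_pair _ _).trans h2), hs, hbits⟩,
      (lt_add_one b).trans_le h1⟩
  obtain ⟨H, hHS, hH, c, hc, hpath⟩ := hR A hAS
    (fun s ⟨l, _, m, _, n, _, hs, _⟩ => ⟨l, m, n, hs⟩) hA
  have key : ∀ b, ∃ s, b ≤ s ∧ ∀ x ∈ H, x < b → (c = 1 ∧ C x s) ∨ (c = 0 ∧ ¬ C x s) := by
    intro b
    -- The prefix `t`, of length `j > b`, extends to the string of length `l ≥ j`; so `l` serves as
    -- the stage.
    obtain ⟨t, ⟨s, ⟨l, -, m, -, n, -, hs, hbits⟩, k, l', hk, hl', hkl, hval⟩, j, hj, hbj, hhom⟩ :=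
      hpath b
    obtain rfl := hj.unique hk
    obtain rfl : l = l' := HasLength.unique ⟨m, n, hs⟩ hl'
    have hjl : j ≤ l := (IsFirstOrderPart.le_iff _ _).2 hkl
    refine ⟨l, hbj.le.trans hjl, fun x hx hxb => ?_⟩
    obtain ⟨l₁, m₁, n₁, hs₁, hxl, hcase⟩ :=
      (hval x (hxb.trans hbj) c).1 (hhom x hx j hj (hxb.trans hbj))
    obtain ⟨rfl, rfl, rfl⟩ := hs.unique hs₁
    rwa [hbits x hxl] at hcase
  refine ⟨H, hHS, hH, ?_⟩
  rcases hc with rfl | rfl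
  · refine .inr fun b => ?_
    obtain ⟨s, hs, h⟩ := key b
    exact ⟨s, hs, fun x hx hxb => ((h x hx hxb).resolve_left fun h => zero_ne_one h.1).2⟩
  · refine .inl fun b => ?_
    obtain ⟨s, hs, h⟩ := key b
    exact ⟨s, hs, fun x hx hxb => ((h x hx hxb).resolve_right fun h => one_ne_zero h.1).2⟩

end IsModelRCA0

omit [IsFirstOrderPart M] in
theorem IsPi02.exists_isBdd {A : Set M} (hA : IsPi02 S A) :
    ∃ T : M → M → M → Prop, IsBdd S (fun v => T (v 2) (v 1) (v 0)) ∧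
      ∀ x, x ∈ A ↔ ∀ m, ∃ n, T x m n := by
  obtain ⟨θ, e, E, hE, h⟩ := hA
  exact ⟨fun x m n => θ.Holds E (cons n (cons m (cons x e))), .holds_cons₃ θ e hE 0 1 2, h⟩

theorem IsModelRCA0.pi02Partition (hM : IsModelRCA0 S) (hR : RKLp S) : Pi02Partition S := by
  intro A₀ A₁ h₀ h₁ hA
  obtain ⟨T₀, hT₀, hA₀⟩ := h₀.exists_isBdd
  obtain ⟨T₁, hT₁, hA₁⟩ := h₁.exists_isBdd
  have bound : ∀ {T : M → M → M → Prop}, IsBdd S (fun v => T (v 2) (v 1) (v 0)) →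
      ∀ x a, (∀ m, ∃ n, T x m n) → ∃ B, ∀ m, m < a → ∃ n, n < B ∧ T x m n := by
    intro T hT x a h
    refine hM.exists_bound (P := fun m n => T x m n) ?_ fun m _ => h m
    refine (IsBdd.bex (P := fun v y => y = x ∧ T y (v 1) (v 0)) (.const (x + 1))
      ((hM.isBdd_eq (.var 0) (.const x)).and
        (hT.rename fun k => if k = 0 then 1 else if k = 1 then 2 else 0))).congr fun v => ?_
    exact ⟨fun h => ⟨x, lt_add_one x, rfl, h⟩, fun ⟨y, _, hy, h⟩ => hy ▸ h⟩
  obtain ⟨H, hHS, hH, hhom⟩ := hM.exists_homogeneous_of_RKLp hR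
    (C := fun x s => ∀ m, m < s + 1 → (∀ k, k < m + 1 → ∃ n, n < s + 1 ∧ T₀ x k n) →
      ∀ k, k < m + 1 → ∃ n, n < s + 1 ∧ T₁ x k n)
    (.ball (IsTerm.var 0).succ (.imp
      (.ball (IsTerm.var 0).succ (.bex (IsTerm.var 2).succ
        (hT₀.rename fun k => if k = 0 then 0 else if k = 1 then 1 else 4)))
      (.ball (IsTerm.var 0).succ (.bex (IsTerm.var 2).succ
        (hT₁.rename fun k => if k = 0 then 0 else if k = 1 then 1 else 4)))))
  refine ⟨H, hHS, hH, ?_⟩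
  have hcover : ∀ x, x ∈ A₀ ∨ x ∈ A₁ := fun x => hA.ge (Set.mem_univ x)
  rcases hhom with hhom | hhom
  · refine .inr fun x hx => ?_
    by_contra hx₁
    have hx₀ := (hcover x).resolve_right hx₁
    rw [hA₁] at hx₁
    push Not at hx₁
    obtain ⟨m, hm⟩ := hx₁
    obtain ⟨B, hB⟩ := bound hT₀ x (m + 1) ((hA₀ x).1 hx₀)
    -- The stage must see `x`, exceed the `T₀`-witnesses up to level `m`, and have `m` among the
    -- tested levels.
    obtain ⟨s, hs, hs'⟩ := hhom (max (x + 1) (max B m))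
    simp only [max_le_iff] at hs
    obtain ⟨n, -, hn⟩ := hs' x hx (lt_max_of_lt_left (lt_add_one x)) m
      ((IsFirstOrderPart.lt_succ _ _).2 hs.2.2) (fun k hk => by
        obtain ⟨n, hnB, hn⟩ := hB k hk
        exact ⟨n, (IsFirstOrderPart.lt_succ _ _).2 (hnB.le.trans hs.2.1), hn⟩) m (lt_add_one m)
    exact hm n hn
  · refine .inl fun x hx => ?_
    by_contra hx₀
    have hx₁ := (hcover x).resolve_left hx₀
    rw [hA₀] at hx₀
    push Not at hx₀
    obtain ⟨m, hm⟩ := hx₀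
    obtain ⟨B, hB⟩ := bound hT₁ x (m + 1) ((hA₁ x).1 hx₁)
    obtain ⟨s, hs, hs'⟩ := hhom (max (x + 1) B)
    simp only [max_le_iff] at hs
    refine hs' x hx (lt_max_of_lt_left (lt_add_one x)) fun m' _ h₀ k hk => ?_
    -- `T₀` is never confirmed up to a level `≥ m`; below `m`, the `T₁`-witnesses have appeared by
    -- stage `s`.
    rcases le_or_gt m m' with hle | hlt
    · obtain ⟨n, -, hn⟩ := h₀ m ((IsFirstOrderPart.lt_succ _ _).2 hle)
      exact (hm n hn).elim
    · obtain ⟨n, hnB, hn⟩ := hB k (hk.trans ((add_lt_add_iff_right 1).2 hlt))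
      exact ⟨n, (IsFirstOrderPart.lt_succ _ _).2 (hnB.le.trans hs.2), hn⟩

end Strings

/-! ### The infinite pigeonhole principle -/

section Precedence

variable {M : Type u} [LT M]

/-- The enumeration of the elements below `a` in the order `R` precedes lexicographically the one
in the order `R'`: at the first place where they differ, they have `j` and `j'`, and `j < j'`. -/
def Precedes (a : M) (R R' : M → M → Prop) : Prop :=
  ∃ j, j < a ∧ ∃ j', j' < a ∧ j < j' ∧ (∀ k, k < a → (R k j ↔ R' k j')) ∧
    ∀ k, k < a → ∀ k', k' < a → R k j → R k' j → (R k k' ↔ R' k k')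

variable {a : M} {R R' : M → M → Prop}

theorem Precedes.congr {Q Q' : M → M → Prop}
    (h : ∀ j, j < a → ∀ k, k < a → (R j k ↔ Q j k))
    (h' : ∀ j, j < a → ∀ k, k < a → (R' j k ↔ Q' j k)) (hP : Precedes a R R') :
    Precedes a Q Q' := by
  obtain ⟨j, hj, j', hj', hlt, h1, h2⟩ := hP
  refine ⟨j, hj, j', hj', hlt, fun k hk => ?_, fun k hk k' hk' hkj hkj' => ?_⟩
  · rw [← h k hk j hj, ← h' k hk j' hj', h1 k hk]
  · rw [← h k hk k' hk', ← h' k hk k' hk']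
    exact h2 k hk k' hk' ((h k hk j hj).2 hkj) ((h k' hk' j hj).2 hkj')

end Precedence

section PrecedenceOrder

variable {M : Type u} [LinearOrder M] {a : M} {R R' R'' : M → M → Prop}

theorem Precedes.irrefl [IsStrictTotalOrder M R] : ¬ Precedes a R R := by
  rintro ⟨j, hj, j', hj', hlt, h, -⟩
  rcases trichotomous_of R j j' with h1 | h1 | h1
  · exact irrefl_of R j ((h j hj).2 h1)
  · exact hlt.ne h1
  · exact irrefl_of R j' ((h j' hj').1 h1)

/-- The first difference of `R` and `R''` is at the earlier of the two given ones, whose positions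
are compared inside `R'`. -/
theorem Precedes.trans [IsStrictTotalOrder M R] [IsStrictTotalOrder M R']
    [IsStrictTotalOrder M R''] (h : Precedes a R R') (h' : Precedes a R' R'') :
    Precedes a R R'' := by
  obtain ⟨j, hj, j', hj', hlt, h1, h2⟩ := h
  obtain ⟨k, hk, k', hk', hlt', h1', h2'⟩ := h'
  rcases trichotomous_of R' j' k with hjk | rfl | hjk
  · have below : ∀ i, R' i j' → R' i k := fun i hi => trans_of R' hi hjk
    refine ⟨j, hj, j', hj', hlt, fun i hi => ?_, fun i hi i' hi' hij hij' => ?_⟩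
    · rw [h1 i hi]
      refine ⟨fun h => (h2' i hi j' hj' (below i h) hjk).1 h, fun h => ?_⟩
      have := (h1' i hi).2 (trans_of R'' h ((h1' j' hj').1 hjk))
      exact (h2' i hi j' hj' this hjk).2 h
    · rw [h2 i hi i' hi' hij hij']
      exact h2' i hi i' hi' (below i ((h1 i hi).1 hij)) (below i' ((h1 i' hi').1 hij'))
  · refine ⟨j, hj, k', hk', hlt.trans hlt', fun i hi => (h1 i hi).trans (h1' i hi),
      fun i hi i' hi' hij hij' => (h2 i hi i' hi' hij hij').trans
        (h2' i hi i' hi' ((h1 i hi).1 hij) ((h1 i' hi').1 hij'))⟩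
  · have hkj : R k j := (h1 k hk).2 hjk
    have agree : ∀ i, i < a → (R i k ↔ R' i k) := fun i hi =>
      ⟨fun h => (h2 i hi k hk (trans_of R h hkj) hkj).1 h,
        fun h => (h2 i hi k hk ((h1 i hi).2 (trans_of R' h hjk)) hkj).2 h⟩
    refine ⟨k, hk, k', hk', hlt', fun i hi => (agree i hi).trans (h1' i hi),
      fun i hi i' hi' hik hik' => ?_⟩
    rw [h2 i hi i' hi' (trans_of R hik hkj) (trans_of R hik' hkj)]
    exact h2' i hi i' hi' ((agree i hi).1 hik) ((agree i' hi').1 hik')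

end PrecedenceOrder

/-! ### Ordering by the last hit. -/

section HitOrder

variable {M : Type u} [LT M]

/-- Before stage `s`, the last hit of `j` (if any) comes before that of `k`. -/
def HitBefore (G : M → M → Prop) (s j k : M) : Prop :=
  ∃ y, y < s ∧ G y k ∧ ∀ z, z < s → G z j → z < y

/-- The order by the last hit before stage `s`. -/
def HitOrder (G : M → M → Prop) (s j k : M) : Prop :=
  HitBefore G s j k ∨ ¬ HitBefore G s k j ∧ j < k

end HitOrder

/-! ### The pigeonhole principle from `RKLp`. -/

section Pigeonhole

variable {M : Type u} [ArithStructure M] [IsFirstOrderPart M] {S : Set (Set M)}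

namespace IsModelRCA0

variable {G : M → M → Prop}

/-- `τ s j` is the least strict upper bound of the hits of `j` before `s`, so `0` if there are none.
It turns the hit order into a lexicographic order on pairs. -/
theorem exists_lastHit (hM : IsModelRCA0 S) (hG : IsBdd S (fun v => G (v 1) (v 0))) :
    ∃ τ : M → M → M, ∀ s j t, τ s j ≤ t ↔ ∀ y, y < s → G y j → y < t := by
  have key : ∀ s j, ∃ t, ∀ t', t ≤ t' ↔ ∀ y, y < s → G y j → y < t' := fun s j => by
    obtain ⟨t, ht, hmin⟩ := hM.exists_least
      (P := fun t => ∀ i, i < j + 1 → i = j → ∀ y, y < s → G y i → y < t)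
      (.ball (.const (j + 1)) (.imp (hM.isBdd_eq (.var 0) (.const j)) (.ball (.const s) (.imp
        (hG.rename fun k => if k = 0 then 1 else 0) (hM.isBdd_lt (.var 0) (.var 2))))))
      ⟨s, fun _ _ _ y hy _ => hy⟩
    refine ⟨t, fun t' => ⟨fun h y hy hG => (ht j (lt_add_one j) rfl y hy hG).trans_le h,
      fun h => ?_⟩⟩
    by_contra! hlt
    exact hmin t' hlt fun i _ hi y hy hG => h y hy (hi ▸ hG)
  choose τ hτ using key
  exact ⟨τ, hτ⟩

omit [IsFirstOrderPart M] in
theorem isBdd_hitOrder (hM : IsModelRCA0 S) (hG : IsBdd S (fun v => G (v 1) (v 0))) :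
    IsBdd S (fun v => HitOrder G (v 2) (v 1) (v 0)) := by
  have h : IsBdd S (fun v => HitBefore G (v 2) (v 1) (v 0)) :=
    .bex (.var 2) (.and (hG.rename fun k => if k = 0 then 1 else 0) (.ball (.var 3)
      (.imp (hG.rename fun k => if k = 0 then 3 else 0) (hM.isBdd_lt (.var 0) (.var 1)))))
  exact h.or ((h.rename fun k => if k = 0 then 1 else if k = 1 then 0 else 2).not.and
    (hM.isBdd_lt (.var 1) (.var 0)))

theorem hitBefore_iff {τ : M → M → M} (hτ : ∀ s j t, τ s j ≤ t ↔ ∀ y, y < s → G y j → y < t)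
    (s j k : M) : HitBefore G s j k ↔ τ s j < τ s k := by
  rw [← not_le, hτ]
  push Not
  exact exists_congr fun y => and_congr_right fun _ => and_congr_right fun _ => (hτ s j y).symm

theorem hitOrder_iff {τ : M → M → M} (hτ : ∀ s j t, τ s j ≤ t ↔ ∀ y, y < s → G y j → y < t)
    (s j k : M) : HitOrder G s j k ↔ toLex (τ s j, j) < toLex (τ s k, k) := by
  rw [HitOrder, hitBefore_iff hτ, hitBefore_iff hτ, Prod.Lex.toLex_lt_toLex]
  constructor
  · rintro (h | ⟨h, h'⟩)
    · exact .inl h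
    · exact (not_lt.1 h).lt_or_eq.imp id fun h => ⟨h, h'⟩
  · rintro (h | ⟨h, h'⟩)
    · exact .inl h
    · exact .inr ⟨h.not_gt, h'⟩

theorem isStrictTotalOrder_hitOrder (hM : IsModelRCA0 S)
    (hG : IsBdd S (fun v => G (v 1) (v 0))) (s : M) : IsStrictTotalOrder M (HitOrder G s) := by
  obtain ⟨τ, hτ⟩ := hM.exists_lastHit hG
  have h := hitOrder_iff hτ s
  exact
    { irrefl := fun j hj => ((h j j).1 hj).false
      trans := fun i j k hij hjk => (h i k).2 (((h i j).1 hij).trans ((h j k).1 hjk))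
      trichotomous := fun i j hij hji => by
        rw [h, not_lt] at hij hji
        exact (Prod.ext_iff.1 (toLex.injective (le_antisymm hji hij))).2 }

/-- The first difference of two orders, one of which is `R'`. -/
theorem exists_first_difference (hM : IsModelRCA0 S) {R R' : M → M → Prop}
    [IsStrictTotalOrder M R] [IsStrictTotalOrder M R'] (hR : IsBdd S (fun v => R (v 1) (v 0)))
    (hR' : IsBdd S (fun v => R' (v 1) (v 0))) {a j₀ k₀ : M} (hj₀ : j₀ < a) (hk₀ : k₀ < a)
    (hne : ¬ (R k₀ j₀ ↔ R' k₀ j₀)) :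
    ∃ j, j < a ∧ ∃ j', j' < a ∧ j ≠ j' ∧ (∀ k, k < a → (R k j ↔ R' k j')) ∧
      (∀ k, k < a → ∀ k', k' < a → R' k' j' → (R k k' ↔ R' k k')) ∧ (j' = j₀ ∨ R' j' j₀) := by
  -- `j'` is the `R'`-first element whose predecessors differ in the two orders; the reversed
  -- relation turns maximal into minimal.
  obtain ⟨j', hj', ⟨k₁, hk₁, hne₁⟩, hmin'⟩ := hM.exists_maximal
    (X := fun j => ∃ k, k < a ∧ ¬ (R k j ↔ R' k j)) (R := fun i j => R' j i) (u := a)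
    (.bex (.const a) (.not (.iff (hR.rename fun k => if k = 0 then 1 else 0)
      (hR'.rename fun k => if k = 0 then 1 else 0)))) hR' (irrefl_of R')
    (fun x y z h h' => trans_of R' h' h) ⟨j₀, hj₀, k₀, hk₀, hne⟩
  have agree : ∀ k', k' < a → R' k' j' → ∀ k, k < a → (R k k' ↔ R' k k') := by
    intro k' hk' h k hk
    by_contra hc
    exact hmin' k' hk' ⟨k, hk, hc⟩ h
  -- `j` is the `R`-first element that is not `R'`-before `j'`, that is, the one at the same place
  -- in `R`.
  obtain ⟨j, hj, hjj', hmin⟩ := hM.exists_maximal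
    (X := fun k => ∃ i, i < j' + 1 ∧ i = j' ∧ ¬ R' k i) (R := fun i j => R j i) (u := a)
    (.bex (.const (j' + 1)) (.and (hM.isBdd_eq (.var 0) (.const j'))
      (hR'.rename fun k => if k = 0 then 0 else 1).not)) hR (irrefl_of R)
    (fun x y z h h' => trans_of R h' h) ⟨j', hj', j', lt_add_one j', rfl, irrefl_of R' j'⟩
  obtain ⟨i, -, hi, hjj'⟩ := hjj'
  rw [hi] at hjj'
  have hpred : ∀ k, k < a → (R k j ↔ R' k j') := by
    intro k hk
    constructor
    · intro h
      by_contra hc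
      exact hmin k hk ⟨_, lt_add_one _, rfl, hc⟩ h
    · intro h
      rcases trichotomous_of R k j with h1 | rfl | h1
      · exact h1
      · exact (hjj' h).elim
      · exact (hjj' (trans_of R' ((agree k hk h j hj).1 h1) h)).elim
  refine ⟨j, hj, _, hj', ?_, hpred, fun k hk k' hk' h => agree k' hk' h k hk, ?_⟩
  · rintro rfl
    exact hne₁ (hpred k₁ hk₁)
  · rcases trichotomous_of R' j₀ _ with h | h | h
    · exact (hmin' j₀ hj₀ ⟨k₀, hk₀, hne⟩ h).elim
    · exact .inl h.symm
    · exact .inr h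

/-- Each stage is eventually before, or eventually after, the later stages. -/
theorem eventually_precedes (hM : IsModelRCA0 S) (hG : IsBdd S (fun v => G (v 1) (v 0))) {a : M}
    (hbdd : ∀ j, j < a → ∃ b, ∀ y, G y j → y < b) (hinf : ∀ b, ∃ y, b ≤ y ∧ ∃ j, j < a ∧ G y j)
    (x : M) :
    ∃ B, (∀ s, B ≤ s → Precedes a (HitOrder G x) (HitOrder G s)) ∨
      ∀ s, B ≤ s → Precedes a (HitOrder G s) (HitOrder G x) := by
  have hord := hM.isStrictTotalOrder_hitOrder hG
  obtain ⟨τ, hτ⟩ := hM.exists_lastHit hG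
  have hR : ∀ s, IsBdd S (fun v => HitOrder G s (v 1) (v 0)) := fun s => by
    refine (IsBdd.bex (P := fun v i => i = s ∧ HitOrder G i (v 1) (v 0)) (.const (s + 1))
      ((hM.isBdd_eq (.var 0) (.const s)).and ((hM.isBdd_hitOrder hG).rename
        fun k => if k = 0 then 1 else if k = 1 then 2 else 0))).congr fun v => ?_
    exact ⟨fun h => ⟨s, lt_add_one s, rfl, h⟩, fun ⟨y, _, hy, h⟩ => hy ▸ h⟩
  obtain ⟨-, -, i, hi, -⟩ := hinf 0
  -- `jm` is last at stage `x`. A hit `y₀` after all hits of `jm` belongs to some `j₀`, which is no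
  -- longer hit from `t` on.
  obtain ⟨jm, hjm, -, hmax⟩ := hM.exists_maximal (X := fun j => j = j) (R := HitOrder G x)
    (hM.isBdd_eq (.var 0) (.var 0)) ((hR x).rename fun k => if k = 0 then 1 else 0)
    (irrefl_of _) (fun _ _ _ => trans_of _) ⟨i, hi, rfl⟩
  obtain ⟨b, hb⟩ := hbdd jm hjm
  obtain ⟨y₀, hby₀, j₀, hj₀, hGy₀⟩ := hinf b
  obtain ⟨t, ht⟩ := hbdd j₀ hj₀
  -- By stage `B` every `i < a` that is hit at or after `t` has been so hit. From `max t B` on,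
  -- these elements come after the settled ones, whose order is fixed.
  obtain ⟨B, hB⟩ := hM.exists_strong_bound (P := fun i m => t ≤ m ∧ G m i)
    ((hM.isBdd_le (.const t) (.var 0)).and (hG.rename fun k => if k = 0 then 1 else 0)) a
  have hy₀t : y₀ < t := ht y₀ hGy₀
  have settled : ∀ s, t ≤ s → ∀ i, (∀ m, t ≤ m → ¬ G m i) → τ s i = τ t i := fun s hs i hi => by
    refine eq_of_forall_ge_iff fun c => ?_
    rw [hτ, hτ]
    refine ⟨fun h y hy => h y (hy.trans_le hs), fun h y _ hG => h y ?_ hG⟩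
    by_contra! hty
    exact hi y hty hG
  have small_le : ∀ s i, (∀ m, t ≤ m → ¬ G m i) → τ s i ≤ t := fun s i hi => by
    refine (hτ _ _ _).2 fun y _ hG => ?_
    by_contra! hty
    exact hi y hty hG
  have large : ∀ s, B ≤ s → ∀ i, i < a → (¬ ∀ m, t ≤ m → ¬ G m i) → t < τ s i :=
    fun s hs i hi hex => by
      push Not at hex
      obtain ⟨m, hmB, htm, hm⟩ := hB i hi hex
      by_contra! hle
      exact ((hτ s i t).1 hle m (hmB.trans_le hs) hm).not_ge htm
  have hj₀small : ∀ m, t ≤ m → ¬ G m j₀ := fun m hm h => (ht m h).not_ge hm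
  have stable : ∀ s, max t B ≤ s → ∀ k, (∀ m, t ≤ m → ¬ G m k) → ∀ i, i < a →
      (HitOrder G s i k ↔ HitOrder G (max t B) i k) := fun s hs k hk i hi => by
    rw [hitOrder_iff hτ, hitOrder_iff hτ]
    by_cases hismall : ∀ m, t ≤ m → ¬ G m i
    · rw [settled s ((le_max_left _ _).trans hs) i hismall,
        settled s ((le_max_left _ _).trans hs) k hk, settled _ (le_max_left _ _) i hismall,
        settled _ (le_max_left _ _) k hk]
    · have hno : ∀ s, B ≤ s → ¬ toLex (τ s i, i) < toLex (τ s k, k) := fun s hs h => by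
        have h1 := large s hs i hi hismall
        have h2 := small_le s k hk
        rw [Prod.Lex.toLex_lt_toLex] at h
        rcases h with h | h
        · exact (h1.trans h).not_ge h2
        · exact (h1.trans_eq h.1).not_ge h2
      exact iff_of_false (hno s ((le_max_right _ _).trans hs)) (hno _ (le_max_right _ _))
  have hlt : HitOrder G (max t B) jm j₀ := by
    rw [hitOrder_iff hτ, Prod.Lex.toLex_lt_toLex]
    refine .inl (lt_of_le_of_lt (b := y₀) ?_ ?_)
    · exact (hτ _ _ _).2 fun y _ hG => (hb y hG).trans_le hby₀
    · by_contra! hle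
      exact ((hτ _ _ _).1 hle y₀ (hy₀t.trans_le (le_max_left _ _)) hGy₀).false
  -- The late order puts `jm` before `j₀`, the order at `x` does not. The first difference is thus
  -- at or before `j₀`, in the settled part, and persists at all later stages.
  obtain ⟨j, hj, j', hj', hne, hpred, hagree, hj'₀⟩ := hM.exists_first_difference (hR x)
    (hR (max t B)) hj₀ hjm (fun h => hmax j₀ hj₀ rfl (h.2 hlt))
  have small_of_lt : ∀ k, k < a → ∀ j, (∀ m, t ≤ m → ¬ G m j) → HitOrder G (max t B) k j →
      ∀ m, t ≤ m → ¬ G m k := fun k hk j hjs h => by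
    by_contra hc
    have h1 := large _ (le_max_right t B) k hk hc
    have h2 := small_le (max t B) j hjs
    rw [hitOrder_iff hτ, Prod.Lex.toLex_lt_toLex] at h
    rcases h with h | h
    · exact (h1.trans h).not_ge h2
    · exact (h1.trans_eq h.1).not_ge h2
  have hj'small : ∀ m, t ≤ m → ¬ G m j' := by
    rcases hj'₀ with rfl | h
    · exact hj₀small
    · exact small_of_lt j' hj' j₀ hj₀small h
  refine ⟨max t B, ?_⟩
  rcases hne.lt_or_gt with hjj' | hjj'
  · refine .inl fun s hs => ⟨j, hj, j', hj', hjj', fun k hk => ?_, fun k hk k' hk' _ hk'j => ?_⟩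
    · rw [hpred k hk, stable s hs j' hj'small k hk]
    · have h := (hpred k' hk').1 hk'j
      rw [hagree k hk k' hk' h, stable s hs k' (small_of_lt k' hk' j' hj'small h) k hk]
  · refine .inr fun s hs => ⟨j', hj', j, hj, hjj', fun k hk => ?_, fun k hk k' hk' _ hk'j => ?_⟩
    · rw [hpred k hk, stable s hs j' hj'small k hk]
    · have h := (stable s hs j' hj'small k' hk').1 hk'j
      rw [hagree k hk k' hk' h, stable s hs k' (small_of_lt k' hk' j' hj'small h) k hk]

omit [IsFirstOrderPart M] in
theorem isBdd_precedes (hM : IsModelRCA0 S) {R : M → M → M → Prop}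
    (hR : IsBdd S (fun v => R (v 2) (v 1) (v 0))) (a : M) :
    IsBdd S (fun v => Precedes a (R (v 1)) (R (v 0))) :=
  .bex (.const a) (.bex (.const a) (.and (hM.isBdd_lt (.var 1) (.var 0)) (.and
    (.ball (.const a) (.iff (hR.rename fun k => if k = 0 then 2 else if k = 1 then 0 else 4)
      (hR.rename fun k => if k = 0 then 1 else if k = 1 then 0 else 3)))
    (.ball (.const a) (.ball (.const a) (.imp
      (hR.rename fun k => if k = 0 then 3 else if k = 1 then 1 else 5) (.imp
      (hR.rename fun k => if k = 0 then 3 else if k = 1 then 0 else 5) (.iff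
      (hR.rename fun k => if k = 0 then 0 else if k = 1 then 1 else 5)
      (hR.rename fun k => if k = 0 then 0 else if k = 1 then 1 else 4)))))))))

theorem pair_lt_pair {j k a : M} (hj : j < a) (hk : k < a) : pair j k < pair a a := by
  unfold pair
  gcongr

/-- Finitely many relations on the elements below `a` occur in a sequence of relations. -/
theorem exists_bound_relations (hM : IsModelRCA0 S) {R : M → M → M → Prop}
    (hR : IsBdd S (fun v => R (v 2) (v 1) (v 0))) (a : M) {H : Set M} (hH : H ∈ S) :
    ∃ B, ∀ x ∈ H, ∃ y, y < B ∧ y ∈ H ∧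
      ∀ j, j < a → ∀ k, k < a → (R x j k ↔ R y j k) := by
  -- `N` bounds the codes of all relations below `a`, so strong bounding over codes finds an early
  -- representative of each one that occurs in `H`.
  obtain ⟨m, N, hcode⟩ := hM.exists_code (pair a a)
  obtain ⟨B, hB⟩ := hM.exists_strong_bound
    (P := fun n x => x ∈ H ∧ ∀ j, j < a → ∀ k, k < a → (Bit m n (pair j k) ↔ R x j k))
    (.and (.mem hH (.var 0)) (.ball (.const a) (.ball (.const a) (.iff
      (hM.isBdd_bit (.const m) (.var 3) (.pair (.var 1) (.var 0)))
      (hR.rename fun k => if k = 0 then 0 else if k = 1 then 1 else 2))))) N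
  refine ⟨B, fun x hx => ?_⟩
  obtain ⟨n, hnN, hn⟩ := hcode (fun i x' => x' = x ∧ ∃ j, j < a ∧ ∃ k, k < a ∧ i = pair j k ∧
    R x' j k) (.and (hM.isBdd_eq (.var 0) (.const x)) (.bex (.const a) (.bex (.const a) (.and
      (hM.isBdd_eq (.var 3) (.pair (.var 1) (.var 0)))
      (hR.rename fun k => if k = 0 then 0 else if k = 1 then 1 else 2)))))
  have hbit : ∀ j, j < a → ∀ k, k < a → (Bit m n (pair j k) ↔ R x j k) := fun j hj k hk => by
    rw [hn _ (pair_lt_pair hj hk)]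
    constructor
    · rintro ⟨_, rfl, j', -, k', -, hjk, h⟩
      obtain ⟨rfl, rfl⟩ := pair_inj hjk
      exact h
    · exact fun h => ⟨x, rfl, j, hj, k, hk, rfl, h⟩
  obtain ⟨y, hyB, hyH, hy⟩ := hB n hnN ⟨x, hx, hbit⟩
  exact ⟨y, hyB, hyH, fun j hj k hk => (hbit j hj k hk).symm.trans (hy j hj k hk)⟩

/-- If each `j < a` is hit boundedly often, the hits are bounded. -/
theorem pigeonhole_of_RKLp (hM : IsModelRCA0 S) (hR : RKLp S)
    (hG : IsBdd S (fun v => G (v 1) (v 0))) {a : M}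
    (hbdd : ∀ j, j < a → ∃ b, ∀ y, G y j → y < b) : ∃ b, ∀ y, b ≤ y → ∀ j, j < a → ¬ G y j := by
  by_contra! hinf
  have hord := hM.isStrictTotalOrder_hitOrder hG
  have hpre := hM.isBdd_precedes (hM.isBdd_hitOrder hG) a
  obtain ⟨H, hHS, hH, hhom⟩ := hM.exists_homogeneous_of_RKLp hR
    (C := fun x s => Precedes a (HitOrder G x) (HitOrder G s)) hpre
  obtain ⟨B, hB⟩ := hM.exists_bound_relations (hM.isBdd_hitOrder hG) a hHS
  obtain ⟨x₀, hx₀, -⟩ := hH 0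
  obtain ⟨y₀, hy₀B, hy₀, -⟩ := hB x₀ hx₀
  rcases hhom with hhom | hhom
  · obtain ⟨x, -, hx, hmax⟩ := hM.exists_maximal (X := fun x => x ∈ H)
      (R := fun x y => Precedes a (HitOrder G x) (HitOrder G y)) (.mem hHS (.var 0))
      (hpre.rename fun k => if k = 0 then 1 else 0) (fun _ => Precedes.irrefl)
      (fun _ _ _ => Precedes.trans) ⟨y₀, hy₀B, hy₀⟩
    obtain ⟨b, hb | hb⟩ := hM.eventually_precedes hG hbdd hinf x
    · obtain ⟨y, hy, hby⟩ := hH b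
      obtain ⟨z, hzB, hz, hyz⟩ := hB y hy
      exact hmax z hzB hz ((hb y hby.le).congr (fun _ _ _ _ => Iff.rfl) hyz)
    · obtain ⟨s, hs, h⟩ := hhom (max b (x + 1))
      exact Precedes.irrefl ((h x hx (lt_max_of_lt_right (lt_add_one x))).trans
        (hb s ((le_max_left _ _).trans hs)))
  · obtain ⟨x, -, hx, hmin⟩ := hM.exists_maximal (X := fun x => x ∈ H)
      (R := fun x y => Precedes a (HitOrder G y) (HitOrder G x)) (.mem hHS (.var 0))
      hpre (fun _ => Precedes.irrefl) (fun _ _ _ h h' => h'.trans h) ⟨y₀, hy₀B, hy₀⟩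
    obtain ⟨b, hb | hb⟩ := hM.eventually_precedes hG hbdd hinf x
    · obtain ⟨s, hs, h⟩ := hhom (max b (x + 1))
      exact h x hx (lt_max_of_lt_right (lt_add_one x)) (hb s ((le_max_left _ _).trans hs))
    · obtain ⟨y, hy, hby⟩ := hH b
      obtain ⟨z, hzB, hz, hyz⟩ := hB y hy
      exact hmin z hzB hz ((hb y hby.le).congr hyz (fun _ _ _ _ => Iff.rfl))

end IsModelRCA0

end Pigeonhole

/-! ### Stable colorings -/

section StableColorings

variable {M : Type u} [ArithStructure M] [IsFirstOrderPart M] {S : Set (Set M)}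

/-- The bits of `m, n` below `l` are those of the greedy subset of `H` that is homogeneous for the
relation `f`. -/
def IsGreedy (H : Set M) (f : M → M → Prop) (l m n : M) : Prop :=
  ∀ z, z < l → (Bit m n z ↔ z ∈ H ∧ ∀ y, y < z → Bit m n y → f y z)

namespace IsModelRCA0

variable {H : Set M} {f : M → M → Prop}

theorem isBdd_isGreedy (hM : IsModelRCA0 S) (hH : H ∈ S) (hf : IsBdd S (fun v => f (v 1) (v 0)))
    {k g h : (ℕ → M) → M} (hk : IsTerm k) (hg : IsTerm g) (hh : IsTerm h) :
    IsBdd S (fun v => IsGreedy H f (k v) (g v) (h v)) :=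
  .ball hk (.iff (hM.isBdd_bit hg.comp_succ hh.comp_succ (.var 0)) (.and (.mem hH (.var 0))
    (.ball (.var 0) (.imp (hM.isBdd_bit hg.comp_succ.comp_succ hh.comp_succ.comp_succ (.var 0))
      (hf.rename fun k => if k = 0 then 1 else 0)))))

theorem bit_iff_of_isGreedy (hM : IsModelRCA0 S) {l m n l' m' n' : M} (h : IsGreedy H f l m n)
    (h' : IsGreedy H f l' m' n') {z : M} (hz : z < l) (hz' : z < l') :
    Bit m n z ↔ Bit m' n' z := by
  by_contra hne
  obtain ⟨x, ⟨hx, hx', hne⟩, hmin⟩ := hM.exists_least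
    (P := fun x => x < l ∧ x < l' ∧ ¬ (Bit m n x ↔ Bit m' n' x))
    (.and (hM.isBdd_lt (.var 0) (.const l)) (.and (hM.isBdd_lt (.var 0) (.const l'))
      (.not (.iff (hM.isBdd_bit (.const m) (.const n) (.var 0))
        (hM.isBdd_bit (.const m') (.const n') (.var 0)))))) ⟨z, hz, hz', hne⟩
  refine hne ?_
  rw [h x hx, h' x hx']
  refine and_congr_right fun _ => forall_congr' fun y => forall_congr' fun hy => ?_
  have := hmin y hy
  simp only [hy.trans hx, hy.trans hx', true_and, not_not] at this
  rw [this]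

theorem exists_isGreedy (hM : IsModelRCA0 S) (hH : H ∈ S)
    (hf : IsBdd S (fun v => f (v 1) (v 0))) (l : M) : ∃ m n : M, IsGreedy H f l m n := by
  have key := hM.sigma_induction (P := fun l p => ∃ m, m < p ∧ ∃ n, n < p ∧ IsGreedy H f l m n)
    (.bex (.var 0) (.bex (.var 1) (hM.isBdd_isGreedy hH hf (.var 3) (.var 1) (.var 0))))
    ⟨1, 0, one_pos, 0, one_pos, fun z hz => (hM.not_lt_zero z hz).elim⟩
    (fun l ⟨p, m, _, n, _, h⟩ => by
      obtain ⟨-, m', n', -, hbits⟩ := hM.exists_isCode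
        (P := fun z => z ∈ H ∧ ∀ y, y < z → Bit m n y → f y z)
        (.and (.mem hH (.var 0)) (.ball (.var 0) (.imp
          (hM.isBdd_bit (.const m) (.const n) (.var 0))
          (hf.rename fun k => if k = 0 then 1 else 0)))) (l + 1)
      have hag : ∀ z, z < l → (Bit m' n' z ↔ Bit m n z) := fun z hz => by
        rw [hbits z (hz.trans (lt_add_one l)), h z hz]
      refine ⟨max m' n' + 1, m', (IsFirstOrderPart.lt_succ _ _).2 (le_max_left _ _), n',
        (IsFirstOrderPart.lt_succ _ _).2 (le_max_right _ _), fun z hz => ?_⟩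
      rw [hbits z hz]
      refine and_congr_right fun _ => forall_congr' fun y => forall_congr' fun hy => ?_
      rw [hag y (hy.trans_le ((IsFirstOrderPart.lt_succ _ _).1 hz))]) l
  obtain ⟨p, m, -, n, -, h⟩ := key
  exact ⟨m, n, h⟩

/-- The greedy homogeneous subset of `H`. -/
theorem exists_greedy_subset (hM : IsModelRCA0 S) (hH : H ∈ S)
    (hf : IsBdd S (fun v => f (v 1) (v 0))) :
    ∃ K ∈ S, ∀ z, z ∈ K ↔ z ∈ H ∧ ∀ y ∈ K, y < z → f y z := by
  have hP : IsBdd S (fun v => ∃ m, m < v 0 ∧ ∃ n, n < v 0 ∧ IsGreedy H f (v 1 + 1) m n ∧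
      Bit m n (v 1)) :=
    .bex (.var 0) (.bex (.var 1) (.and
      (hM.isBdd_isGreedy hH hf (IsTerm.var 3).succ (.var 1) (.var 0))
      (hM.isBdd_bit (.var 1) (.var 0) (.var 3))))
  have hQ : IsBdd S (fun v => ∀ m, m < v 0 → ∀ n, n < v 0 → IsGreedy H f (v 1 + 1) m n →
      Bit m n (v 1)) :=
    .ball (.var 0) (.ball (.var 1) (.imp
      (hM.isBdd_isGreedy hH hf (IsTerm.var 3).succ (.var 1) (.var 0))
      (hM.isBdd_bit (.var 1) (.var 0) (.var 3))))
  have hex : ∀ z {m n : M}, IsGreedy H f (z + 1) m n → ((∃ p, ∃ m, m < p ∧ ∃ n, n < p ∧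
      IsGreedy H f (z + 1) m n ∧ Bit m n z) ↔ Bit m n z) := fun z m n h => by
    constructor
    · rintro ⟨p, m', -, n', -, h', hb⟩
      exact (hM.bit_iff_of_isGreedy h h' (lt_add_one z) (lt_add_one z)).2 hb
    · intro hb
      exact ⟨max m n + 1, m, (IsFirstOrderPart.lt_succ _ _).2 (le_max_left _ _), n,
        (IsFirstOrderPart.lt_succ _ _).2 (le_max_right _ _), h, hb⟩
  -- Codes of the greedy set up to `z` exist and agree, so "some code" and "every code" are
  -- equivalent and the set is `Δ⁰₁`.
  refine ⟨_, hM.setOf_exists_mem (P := fun z p => ∃ m, m < p ∧ ∃ n, n < p ∧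
    IsGreedy H f (z + 1) m n ∧ Bit m n z) (Q := fun z p => ∀ m, m < p → ∀ n, n < p →
    IsGreedy H f (z + 1) m n → Bit m n z) hP hQ fun z => ?_, fun z => ?_⟩
  · obtain ⟨m, n, h⟩ := hM.exists_isGreedy hH hf (z + 1)
    rw [hex z h]
    refine ⟨fun hb p m' _ n' _ h' =>
      (hM.bit_iff_of_isGreedy h h' (lt_add_one z) (lt_add_one z)).1 hb, fun hall => ?_⟩
    exact hall (max m n + 1) m ((IsFirstOrderPart.lt_succ _ _).2 (le_max_left _ _)) n
      ((IsFirstOrderPart.lt_succ _ _).2 (le_max_right _ _)) h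
  · obtain ⟨m, n, h⟩ := hM.exists_isGreedy hH hf (z + 1)
    have hmem : ∀ y, y < z + 1 → ((∃ p, ∃ m, m < p ∧ ∃ n, n < p ∧
        IsGreedy H f (y + 1) m n ∧ Bit m n y) ↔ Bit m n y) := fun y hy =>
      hex y fun w hw => h w (hw.trans_le ((add_le_add_iff_right 1).2
        ((IsFirstOrderPart.lt_succ _ _).1 hy)))
    simp only [Set.mem_ofPred_eq]
    rw [hmem z (lt_add_one z), h z (lt_add_one z)]
    refine and_congr_right fun _ => forall_congr' fun y => ?_
    constructor
    · intro H₁ hy hyz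
      exact H₁ hyz ((hmem y (hyz.trans (lt_add_one z))).1 hy)
    · intro H₁ hyz hy
      exact H₁ ((hmem y (hyz.trans (lt_add_one z))).2 hy) hyz

theorem exists_homogeneous_subset (hM : IsModelRCA0 S) (hR : RKLp S) (hH : H ∈ S)
    (hinf : Unbounded H) (hf : IsBdd S (fun v => f (v 1) (v 0)))
    (hlim : ∀ x ∈ H, ∃ t, ∀ y, t ≤ y → f x y) :
    ∃ K ∈ S, Unbounded K ∧ ∀ x ∈ K, ∀ y ∈ K, x < y → f x y := by
  obtain ⟨K, hKS, hK⟩ := hM.exists_greedy_subset hH hf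
  refine ⟨K, hKS, fun b => ?_, fun x hx y hy hxy => ((hK y).1 hy).2 x hx hxy⟩
  by_contra! hb
  -- A hit of `j` at `y` means that `j` would keep `y` out of `K`. Past `c` no `j ≤ b` does so, and
  -- the next element of `H` enters `K`.
  obtain ⟨c, hc⟩ := hM.pigeonhole_of_RKLp hR (G := fun y j => j ∈ H ∧ ¬ f j y) (a := b + 1)
    ((IsBdd.mem hH (.var 0)).and (hf.rename fun k => if k = 0 then 1 else 0).not)
    (fun j _ => by
      by_cases hj : j ∈ H
      · obtain ⟨t, ht⟩ := hlim j hj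
        refine ⟨t, fun y hy => ?_⟩
        by_contra! hle
        exact hy.2 (ht y hle)
      · exact ⟨0, fun y hy => (hj hy.1).elim⟩)
  obtain ⟨y, hy, hlt⟩ := hinf (max b c)
  rw [max_lt_iff] at hlt
  refine (hb y ((hK y).2 ⟨hy, fun x hx _ => ?_⟩)).not_gt hlt.1
  by_contra hxy
  exact hc y hlt.2.le x ((IsFirstOrderPart.lt_succ _ _).2 (hb x hx)) ⟨((hK x).1 hx).1, hxy⟩

theorem srt22 (hM : IsModelRCA0 S) (hR : RKLp S) : SRT22 S := by
  intro F hF hcol hst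
  have hf : ∀ i : M, IsBdd S (fun v => pair (pair (v 1) (v 0)) i ∈ F) := fun i =>
    .mem hF (.pair (.pair (.var 1) (.var 0)) (.const i))
  -- Cofinally many values `i` is a `Π⁰₂` condition; for a stable coloring it means that the limit
  -- color is `i`.
  let A : M → Set M := fun i => {x | ∀ t, ∃ y, t < y ∧ x < y ∧ pair (pair x y) i ∈ F}
  have hA : ∀ i, IsPi02 S (A i) := fun i =>
    IsBdd.isPi02 (T := fun x t y => t < y ∧ x < y ∧ pair (pair x y) i ∈ F)
      (.and (hM.isBdd_lt (.var 1) (.var 0)) (.and (hM.isBdd_lt (.var 2) (.var 0))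
        (.mem hF (.pair (.pair (.var 2) (.var 0)) (.const i)))))
  have hcover : A 0 ∪ A 1 = Set.univ := by
    refine Set.eq_univ_of_forall fun x => ?_
    obtain ⟨t, hxt, ht⟩ := hst x
    obtain ⟨i, hi, -⟩ := hcol.2 x t hxt
    have hmem : x ∈ A i := fun b => ⟨max b t + 1, (le_max_left b t).trans_lt (lt_add_one _),
      (hxt.trans_le (le_max_right b t)).trans (lt_add_one _),
      (ht _ ((le_max_right b t).trans_lt (lt_add_one _)) i).2 hi⟩
    obtain ⟨x', y', i', -, hi', heq⟩ := hcol.1 _ hi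
    rw [(pair_inj heq).2] at hmem
    rcases hi' with rfl | rfl
    exacts [.inl hmem, .inr hmem]
  obtain ⟨H, hHS, hinf, hsub⟩ := hM.pi02Partition hR (A 0) (A 1) (hA 0) (hA 1) hcover
  obtain ⟨i, hi⟩ : ∃ i, H ⊆ A i := by
    rcases hsub with h | h
    exacts [⟨0, h⟩, ⟨1, h⟩]
  obtain ⟨K, hKS, hK, hhom⟩ := hM.exists_homogeneous_subset hR hHS hinf (hf i) fun x hx => by
    obtain ⟨t, -, ht⟩ := hst x
    obtain ⟨y, hty, -, hy⟩ := hi hx t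
    refine ⟨t + 1, fun z hz => ?_⟩
    exact (ht z ((lt_add_one t).trans_le hz) i).2 ((ht y hty i).1 hy)
  exact ⟨K, hKS, hK, i, hhom⟩

end IsModelRCA0

end StableColorings

end SecondOrderArith

theorem mainTheorem6 {M : Type u} [SecondOrderArith.ArithStructure M] (S : Set (Set M))
    (hM : SecondOrderArith.IsModelRCA0 S) (hR : SecondOrderArith.RKLp S) :
    SecondOrderArith.Pi02Partition S ∧ SecondOrderArith.SRT22 S :=
  haveI : SecondOrderArith.IsFirstOrderPart M := ⟨S, hM⟩
  ⟨hM.pi02Partition hR, hM.srt22 hR⟩
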